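/- Setting. Let $\Theta\subseteq\mathbb R^m$ and $\mathcal Z\subseteq\mathbb R^d$ be non-empty and closed, and let $\mathcal P(\mathcal Z)$ be the set of Borel probability measures on $\mathcal Z$. Let $c:\mathcal Z\times\mathcal Z\to[0,+\infty]$ be a measurable transportation cost with $c(z,\hat z)=0$ if and only if $z=\hat z$, let $\hat{\mathbb P}\in\mathcal P(\mathcal Z)$, $0\le\varepsilon<\infty$, and $$d_c(\mathbb Q,\hat{\mathbb P})=\inf_{\pi\in\Pi(\mathbb Q,\hat{\mathbb P})}\mathbb E_{(Z,\hat Z)\sim\pi}[c(Z,\hat Z)],\qquad \mathbb B=\{\mathbb Q\in\mathcal P(\mathcal Z): d_c(\mathbb Q,\hat{\mathbb P})\le\varepsilon\},$$ where $\Pi(\mathbb Q,\hat{\mathbb P})$ is the set of couplings with first marginal $\mathbb Q$ and second marginal $\hat{\mathbb P}$. Let $\ell:\Theta\times\mathcal Z\to(-\infty,+\infty]$ be such that $\ell(\theta,\cdot)$ is measurable for every $\theta\in\Theta$. Expectations are taken in $[-\infty,+\infty]$ as $\mathbb E_{Z\sim\mathbb Q}[\ell(\theta,Z)]=\mathbb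 E_{Z\sim\mathbb Q}[\ell^+(\theta,Z)]-\mathbb E_{Z\sim\mathbb Q}[\ell^-(\theta,Z)]$ with $\ell^-=-\min\{0,\ell\}$ (the form $\infty-\infty$ does not arise under the conditions of (i), (ii) or (iii)). Consider the following conditions. * (A) $c$ is lower semicontinuous on $\mathcal Z\times\mathcal Z$; for every $\theta\in\Theta$, $\ell(\theta,\cdot)$ is upper semicontinuous and $\hat{\mathbb P}$-integrable. * (B1) There is $\hat z_0\in\mathcal Z$ with $\mathbb E_{Z\sim\hat{\mathbb P}}[c(Z,\hat z_0)]<\infty$. * (B2) There are a metric $\rho$ on $\mathcal Z$ and an integer $p\ge1$ such that $\{z\in\mathcal Z:\rho(z,\hat z)\le t\}$ is compact (in the Euclidean topology) for all $\hat z\in\mathcal Z$, $t\in\mathbb R$, and $c(z,\hat z)\ge\rho(z,\hat z)^p$ for all $z,\hat z\in\mathcal Z$. * (C1) For every $z\in\mathcal Z$, $\ell(\cdot,z)$ is lower semicontinuous on $\Theta$. * (C2) For every $\mathbb Q\in\mathbb B$ and $\bar\theta\in\Theta$ there is a neighbourhood $U$ of $\bar\theta$ such that the family $\{\ell^-(\theta,\cdot):\theta\in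 U\cap\Theta\}$ is uniformly $\mathbb Q$-integrable. * (C3) There is $\mathbb Q\in\mathbb B$ such that $\{\theta\in\Theta:\mathbb E_{Z\sim\mathbb Q}[\ell(\theta,Z)]\le a\}$ is compact for every $a\in\mathbb R$. * (C4) For every $\theta\in\Theta$ there are $g>0$, $\hat z_0\in\mathcal Z$ and a real $r\in(0,p)$ with $\ell(\theta,z)\le g\,[1+\rho(z,\hat z_0)^r]$ for all $z\in\mathcal Z$, where $\rho$ and $p$ are as in (B2). * (D1) There is $\theta\in\Theta$ with $\sup_{\mathbb Q\in\mathbb B}\mathbb E_{Z\sim\mathbb Q}[\ell(\theta,Z)]<+\infty$. * (D2) There is $\mathbb Q\in\mathbb B$ with $\inf_{\theta\in\Theta}\mathbb E_{Z\sim\mathbb Q}[\ell(\theta,Z)]>-\infty$. Theorem (Minimax theorem). Suppose that $\Theta$ is convex and that $\ell(\cdot,z)$ is convex on $\Theta$ for every $z\in\mathcal Z$. (i) If (C1), (C2), (C3) and (D1) hold, then $$\min_{\theta\in\Theta}\sup_{\mathbb Q\in\mathbb B}\mathbb E_{Z\sim\mathbb Q}[\ell(\theta,Z)]=\sup_{\mathbb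 Q\in\mathbb B}\inf_{\theta\in\Theta}\mathbb E_{Z\sim\mathbb Q}[\ell(\theta,Z)],$$ the minimum over $\theta$ being attained. (ii) If (A), (B1), (B2), (C4) and (D2) hold, then $$\inf_{\theta\in\Theta}\sup_{\mathbb Q\in\mathbb B}\mathbb E_{Z\sim\mathbb Q}[\ell(\theta,Z)]=\max_{\mathbb Q\in\mathbb B}\inf_{\theta\in\Theta}\mathbb E_{Z\sim\mathbb Q}[\ell(\theta,Z)],$$ the maximum over $\mathbb Q$ being attained. (iii) If (A), (B1), (B2), (C1)–(C4), (D1) and (D2) hold, then $$\min_{\theta\in\Theta}\sup_{\mathbb Q\in\mathbb B}\mathbb E_{Z\sim\mathbb Q}[\ell(\theta,Z)]=\max_{\mathbb Q\in\mathbb B}\inf_{\theta\in\Theta}\mathbb E_{Z\sim\mathbb Q}[\ell(\theta,Z)]$$ with both extrema attained, by some $\theta^\star\in\Theta$ and $\mathbb Q^\star\in\mathbb B$ which form a Nash equilibrium: $$\mathbb E_{Z\sim\mathbb Q}[\ell(\theta^\star,Z)]\le\mathbb E_{Z\sim\mathbb Q^\star}[\ell(\theta^\star,Z)]\le\mathbb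 E_{Z\sim\mathbb Q^\star}[\ell(\theta,Z)]\qquad\forall\,\theta\in\Theta,\ \mathbb Q\in\mathbb B.$$ -/

import Mathlib

open MeasureTheory Set Topology
open scoped ENNReal NNReal

noncomputable section

namespace DRO

/-- The expectation `E_{Z ∼ Q}[f(Z)]` of an extended-real-valued function, that is, the expectation
of the positive part minus the expectation of the negative part. It is unambiguous unless both
parts have infinite expectation. -/
def expect {Z : Type*} [MeasurableSpace Z] (Q : ProbabilityMeasure Z) (f : Z → EReal) : EReal :=
  ((∫⁻ z, (f z).toENNReal ∂(Q : Measure Z) : ℝ≥0∞) : EReal)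
    - ((∫⁻ z, (-f z).toENNReal ∂(Q : Measure Z) : ℝ≥0∞) : EReal)

/-- The couplings of `P` and `P'`: joint distributions with first marginal `P` and
second marginal `P'`. -/
def couplings {Z : Type*} [MeasurableSpace Z] (P P' : ProbabilityMeasure Z) :
    Set (ProbabilityMeasure (Z × Z)) :=
  {π | (π : Measure (Z × Z)).map Prod.fst = (P : Measure Z) ∧
       (π : Measure (Z × Z)).map Prod.snd = (P' : Measure Z)}

/-- The optimal transport discrepancy `d_c(P, P')`. -/
def otDiscrepancy {Z : Type*} [MeasurableSpace Z] (c : Z → Z → ℝ≥0∞)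
    (P P' : ProbabilityMeasure Z) : ℝ≥0∞ :=
  ⨅ π ∈ couplings P P', ∫⁻ x, c x.1 x.2 ∂(π : Measure (Z × Z))

/-- The ambiguity set `B_ε(P̂) = {Q : d_c(Q, P̂) ≤ ε}`. -/
def ambiguitySet {Z : Type*} [MeasurableSpace Z] (c : Z → Z → ℝ≥0∞) (ε : ℝ≥0)
    (Phat : ProbabilityMeasure Z) : Set (ProbabilityMeasure Z) :=
  {Q | otDiscrepancy c Q Phat ≤ (ε : ℝ≥0∞)}

/-- The worst-case expected loss `sup_{Q ∈ B} E_Q[ℓ(θ, Z)]` of a decision `θ`. -/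
def worstCase {E Z : Type*} [MeasurableSpace Z] (B : Set (ProbabilityMeasure Z))
    (ℓ : E → Z → EReal) (θ : E) : EReal :=
  ⨆ Q ∈ B, expect Q (ℓ θ)

/-- The optimal expected loss `inf_{θ ∈ Θ} E_Q[ℓ(θ, Z)]` under a distribution `Q`. -/
def bestCase {E Z : Type*} [MeasurableSpace Z] (Θ : Set E)
    (ℓ : E → Z → EReal) (Q : ProbabilityMeasure Z) : EReal :=
  ⨅ θ ∈ Θ, expect Q (ℓ θ)

/-- The optimal value `inf_{θ ∈ Θ} sup_{Q ∈ B} E_Q[ℓ(θ, Z)]` of the primal problem. -/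
def primalValue {E Z : Type*} [MeasurableSpace Z] (Θ : Set E) (B : Set (ProbabilityMeasure Z))
    (ℓ : E → Z → EReal) : EReal :=
  ⨅ θ ∈ Θ, worstCase B ℓ θ

/-- The optimal value `sup_{Q ∈ B} inf_{θ ∈ Θ} E_Q[ℓ(θ, Z)]` of the dual problem. -/
def dualValue {E Z : Type*} [MeasurableSpace Z] (Θ : Set E) (B : Set (ProbabilityMeasure Z))
    (ℓ : E → Z → EReal) : EReal :=
  ⨆ Q ∈ B, bestCase Θ ℓ Q

/-- `(θ⋆, Q⋆)` is a Nash equilibrium (saddle point) of the zero-sum game. -/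
def IsNash {E Z : Type*} [MeasurableSpace Z] (Θ : Set E) (B : Set (ProbabilityMeasure Z))
    (ℓ : E → Z → EReal) (θs : E) (Qs : ProbabilityMeasure Z) : Prop :=
  θs ∈ Θ ∧ Qs ∈ B ∧
    (∀ Q ∈ B, expect Q (ℓ θs) ≤ expect Qs (ℓ θs)) ∧
    (∀ θ ∈ Θ, expect Qs (ℓ θs) ≤ expect Qs (ℓ θ))

/-- Convexity on `Θ` of a function with values in `(-∞, ∞]`. -/
def ConvexOnE {E : Type*} [AddCommGroup E] [Module ℝ E] (Θ : Set E) (f : E → EReal) : Prop :=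
  ∀ x ∈ Θ, ∀ y ∈ Θ, ∀ a b : ℝ, 0 ≤ a → 0 ≤ b → a + b = 1 →
    f (a • x + b • y) ≤ (a : EReal) * f x + (b : EReal) * f y

/-- Continuity assumptions: `c` is jointly lower semicontinuous, and for every `θ ∈ Θ` the loss
`ℓ(θ, ·)` is upper semicontinuous and `P̂`-integrable. -/
def ContinuityAssumption {E Z : Type*} [TopologicalSpace Z] [MeasurableSpace Z]
    (Θ : Set E) (c : Z → Z → ℝ≥0∞) (ℓ : E → Z → EReal) (Phat : ProbabilityMeasure Z) : Prop :=
  LowerSemicontinuous (fun x : Z × Z => c x.1 x.2) ∧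
  ∀ θ ∈ Θ, UpperSemicontinuous (ℓ θ) ∧
    (Measurable (ℓ θ) ∧ ∫⁻ z, (ℓ θ z).abs ∂(Phat : Measure Z) < ∞)

/-- There is a reference point `ẑ₀` with `E_{P̂}[c(Z, ẑ₀)] ≤ C < ∞`. -/
def CostIntegrable {Z : Type*} [MeasurableSpace Z]
    (c : Z → Z → ℝ≥0∞) (Phat : ProbabilityMeasure Z) : Prop :=
  ∃ z₀ : Z, ∃ C : ℝ≥0, ∫⁻ z, c z z₀ ∂(Phat : Measure Z) ≤ (C : ℝ≥0∞)

/-- `d` is a metric on the set of points of `Z`. It need not induce the topology of `Z`. -/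
structure IsMetric {Z : Type*} (d : Z → Z → ℝ) : Prop where
  nonneg : ∀ x y, 0 ≤ d x y
  eq_zero_iff : ∀ x y, d x y = 0 ↔ x = y
  symm : ∀ x y, d x y = d y x
  triangle : ∀ x y z, d x z ≤ d x y + d y z

/-- `d` is a metric whose sublevel sets `{z : d(z, ẑ) ≤ t}` are compact (in the given topology
of `Z`), `p ≥ 1` is an integer, and `c(z, ẑ) ≥ d(z, ẑ)^p`. -/
def CostLowerBound {Z : Type*} [TopologicalSpace Z]
    (c : Z → Z → ℝ≥0∞) (d : Z → Z → ℝ) (p : ℕ) : Prop :=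
  IsMetric d ∧ (∀ (zhat : Z) (t : ℝ), IsCompact {z | d z zhat ≤ t}) ∧ 1 ≤ p ∧
    ∀ z zhat, ENNReal.ofReal (d z zhat ^ p) ≤ c z zhat

/-- For every `z`, the loss `ℓ(·, z)` is lower semicontinuous on `Θ`. -/
def LossLsc {E Z : Type*} [TopologicalSpace E] (Θ : Set E) (ℓ : E → Z → EReal) : Prop :=
  ∀ z, LowerSemicontinuousOn (fun θ => ℓ θ z) Θ

/-- For every `Q ∈ B` and `θ̄ ∈ Θ` there is a neighbourhood `U` of `θ̄` such that the family
`ℓ⁻(θ, ·) = -min {0, ℓ(θ, ·)}`, `θ ∈ U ∩ Θ`, is uniformly `Q`-integrable. (The values are real,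
as the loss never takes the value `-∞`.) -/
def LossNegUnifIntegrable {E Z : Type*} [TopologicalSpace E] [MeasurableSpace Z]
    (Θ : Set E) (B : Set (ProbabilityMeasure Z)) (ℓ : E → Z → EReal) : Prop :=
  ∀ Q ∈ B, ∀ θbar ∈ Θ, ∃ U ∈ 𝓝 θbar,
    UniformIntegrable (fun (θ : ↥(U ∩ Θ)) (z : Z) => (-min 0 (ℓ θ z)).toReal) 1 (Q : Measure Z)

/-- For some `Q ∈ B`, the function `θ ↦ E_Q[ℓ(θ, Z)]` is inf-compact on `Θ`. -/
def LossInfCompact {E Z : Type*} [TopologicalSpace E] [MeasurableSpace Z]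
    (Θ : Set E) (B : Set (ProbabilityMeasure Z)) (ℓ : E → Z → EReal) : Prop :=
  ∃ Q ∈ B, ∀ a : ℝ, IsCompact {θ | θ ∈ Θ ∧ expect Q (ℓ θ) ≤ (a : EReal)}

/-- For every `θ ∈ Θ` there are `g > 0`, `ẑ₀` and `r ∈ (0, p)` with
`ℓ(θ, z) ≤ g (1 + d(z, ẑ₀)^r)` for all `z`. -/
def LossGrowth {E Z : Type*} (Θ : Set E) (ℓ : E → Z → EReal) (d : Z → Z → ℝ) (p : ℕ) : Prop :=
  ∀ θ ∈ Θ, ∃ g : ℝ, 0 < g ∧ ∃ z₀ : Z, ∃ r : ℝ, 0 < r ∧ r < (p : ℝ) ∧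
    ∀ z, ℓ θ z ≤ ((g * (1 + d z z₀ ^ r) : ℝ) : EReal)

/-- Some decision `θ ∈ Θ` has a worst-case expected loss smaller than `+∞`. -/
def ProperPrimal {E Z : Type*} [MeasurableSpace Z]
    (Θ : Set E) (B : Set (ProbabilityMeasure Z)) (ℓ : E → Z → EReal) : Prop :=
  ∃ θ ∈ Θ, worstCase B ℓ θ < ⊤

/-- Under some `Q ∈ B` the optimal expected loss is larger than `-∞`. -/
def ProperDual {E Z : Type*} [MeasurableSpace Z]
    (Θ : Set E) (B : Set (ProbabilityMeasure Z)) (ℓ : E → Z → EReal) : Prop :=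
  ∃ Q ∈ B, ⊥ < bestCase Θ ℓ Q

end DRO

end

/-! All three parts rest on one minimax theorem, `exists_iSup_le_iSup_iInf`, for `F : X → Y → EReal`
with values in (-∞, ∞]. It is applied to `X = Θ`, `Y = B`, `F = E_Q[ℓ]` for (i), and to `X = B`, `Y
= Θ`, `F = E_Q[-ℓ]` for (ii). Part (iii) combines the two optimisers; equality of the values makes
them a saddle point.

Proof of the minimax theorem: let `v` be the sup-inf value. Sublevel sets are closed and one family
of them is compact, so it suffices to solve finitely many inequalities `F x y ≤ α` with `α > v`. If
they had no common solution, Hahn–Banach would give weights `w` averaging them to at least `α`, and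
concavelikeness would turn the average into a single `y'` with `inf_x F x y' > v`. The obstacle is
the value ∞: where `w y = 0`, the averaged inequality says nothing about those `x` with `F x y = ∞`.
The weights are therefore made strictly positive by a small perturbation `τ * k`, harmless because
`∑ k y * F x y` is bounded below, by inf-compactness and convexity (`exists_add_mul_bddBelow`).

Semicontinuity of expectations comes from `lowerSemicontinuousAt_expect`: shift by `M`, truncate at
zero, and control the tail below `-M` uniformly. In (i) the tail is small by uniform integrability
and the truncated part is handled by Fatou. In (ii) the tail is small because the loss grows more
slowly than `d ^ p`, whose moments are bounded on `B`, and the truncated part is handled by the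
portmanteau theorem. Weak compactness of `B` (`isCompact_ambiguitySet`) follows from Prokhorov's
theorem for transport plans. -/

noncomputable section

namespace DRO

/-! ### A minimax theorem for extended-real-valued functions. -/

section Minimax

variable {X Y : Type*}

/-- `F` is convexlike in its first argument. -/
def Convexlike (F : X → Y → EReal) : Prop :=
  ∀ x₁ x₂ : X, ∀ a b : ℝ, 0 < a → 0 < b → a + b = 1 →
    ∃ x, ∀ y, ∀ u₁ u₂ : ℝ, F x₁ y ≤ u₁ → F x₂ y ≤ u₂ → F x y ≤ ((a * u₁ + b * u₂ : ℝ) : EReal)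

/-- `F` is concavelike in its second argument. -/
def Concavelike (F : X → Y → EReal) : Prop :=
  ∀ y₁ y₂ : Y, ∀ a b : ℝ, 0 < a → 0 < b → a + b = 1 →
    ∃ y, ∀ x, ∀ u₁ u₂ : ℝ, (u₁ : EReal) ≤ F x y₁ → (u₂ : EReal) ≤ F x y₂ →
      ((a * u₁ + b * u₂ : ℝ) : EReal) ≤ F x y

/-- Points are merged one at a time, each step needing positive weights. Real minorants `u` keep
infinities out of the sums, yet lose nothing: where `F x y = ⊤`, `u y` may be as large as desired.
-/
theorem Concavelike.exists_finset_mixture {F : X → Y → EReal} (hF : Concavelike F)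
    {t : Finset Y} (ht : t.Nonempty) (w : Y → ℝ) (hw : ∀ y, 0 < w y) :
    ∃ y', ∀ x, ∀ u : Y → ℝ, (∀ y ∈ t, (u y : EReal) ≤ F x y) →
      (((∑ y ∈ t, w y * u y) / ∑ y ∈ t, w y : ℝ) : EReal) ≤ F x y' := by
  induction ht using Finset.Nonempty.cons_induction with
  | singleton a =>
    refine ⟨a, fun x u hu => ?_⟩
    have := hu a (by simp)
    simpa [mul_div_cancel_left₀ _ (hw a).ne'] using this
  | cons a s ha hs ih =>
    obtain ⟨y', hy'⟩ := ih
    have hW : 0 < ∑ y ∈ s, w y := Finset.sum_pos (fun y _ => hw y) hs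
    have hT : 0 < w a + ∑ y ∈ s, w y := add_pos (hw a) hW
    obtain ⟨y, hy⟩ := hF a y' (w a / (w a + ∑ y ∈ s, w y))
      ((∑ y ∈ s, w y) / (w a + ∑ y ∈ s, w y)) (div_pos (hw a) hT) (div_pos hW hT)
      (by rw [← add_div, div_self hT.ne'])
    refine ⟨y, fun x u hu => ?_⟩
    have h := hy x (u a) _ (hu a (by simp))
      (hy' x u fun y hy => hu y (Finset.mem_cons_of_mem hy))
    rw [Finset.sum_cons, Finset.sum_cons]
    convert h using 2
    field_simp

open Classical in
/-- A finite system of inequalities `F x y ≤ α` violated at every `x` is violated on average,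
for some nonnegative weights. -/
theorem exists_weights_of_forall_exists_lt {F : X → Y → EReal} (hconv : Convexlike F)
    {x₀ : X} (hx₀ : ∀ y, F x₀ y ≠ ⊤) {t : Finset Y} {α : ℝ}
    (h : ∀ x, ∃ y ∈ t, (α : EReal) < F x y) :
    ∃ w : Y → ℝ, (∀ y, 0 ≤ w y) ∧ ∑ y ∈ t, w y = 1 ∧
      ∀ x, ∀ u : Y → ℝ, (∀ y ∈ t, F x y ≤ u y) → α ≤ ∑ y ∈ t, w y * u y := by
  set C : Set (t → ℝ) := {u | ∃ x, ∀ y : t, F x y ≤ u y} with hC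
  set O : Set (t → ℝ) := {u | ∀ y, u y < α} with hO
  have hOo : IsOpen O := by
    have : O = Set.pi univ fun _ => Iio α := by ext; simp [hO]
    rw [this]
    exact isOpen_set_pi finite_univ fun _ _ => isOpen_Iio
  have hOc : Convex ℝ O := by
    have : O = Set.pi univ fun _ => Iio α := by ext; simp [hO]
    rw [this]
    exact convex_pi fun _ _ => convex_Iio α
  have hCc : Convex ℝ C := by
    rw [convex_iff_forall_pos]
    rintro u ⟨x₁, h₁⟩ v ⟨x₂, h₂⟩ a b ha hb hab
    obtain ⟨x, hx⟩ := hconv x₁ x₂ a b ha hb hab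
    exact ⟨x, fun y => hx y _ _ (h₁ y) (h₂ y)⟩
  have hdisj : Disjoint O C := by
    rw [Set.disjoint_left]
    rintro u hu ⟨x, hx⟩
    obtain ⟨y, hy, hlt⟩ := h x
    have h1 := hlt.trans_le (hx ⟨y, hy⟩)
    have h2 := hu ⟨y, hy⟩
    norm_cast at h1
    linarith
  obtain ⟨f, s, hfO, hfC⟩ := geometric_hahn_banach_open hOc hOo hCc hdisj
  have hsum : ∀ u : t → ℝ, f u = ∑ y : t, u y * f (Pi.single y 1) := by
    intro u
    conv_lhs => rw [← Finset.univ_sum_single u]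
    rw [map_sum]
    refine Finset.sum_congr rfl fun y _ => ?_
    rw [← smul_eq_mul, ← map_smul, ← Pi.single_smul, smul_eq_mul, mul_one]
  have hlam : ∀ y : t, 0 ≤ f (Pi.single y 1) := by
    intro y
    by_contra! hneg
    -- `O` is stable under decreasing a coordinate; `N` is the step that would raise `f` from `f u`
    -- to at least `s` if the coefficient were negative.
    set u : t → ℝ := fun _ => α - 1
    set N : ℝ := |s - f u| / -f (Pi.single y 1)
    have hN : 0 ≤ N := div_nonneg (abs_nonneg _) (by linarith)
    have hmem : u - N • Pi.single y 1 ∈ O := by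
      intro z
      have : 0 ≤ (Pi.single y 1 : t → ℝ) z := by
        by_cases hz : z = y
        · subst hz; simp
        · simp [hz]
      have := mul_nonneg hN this
      simp only [Pi.sub_apply, Pi.smul_apply, smul_eq_mul, u]
      linarith
    have h1 := hfO _ hmem
    rw [map_sub, map_smul, smul_eq_mul] at h1
    have h2 : N * f (Pi.single y 1) = -|s - f u| := by
      simp only [N]
      rw [div_neg, neg_mul, div_mul_cancel₀ _ hneg.ne]
    have := le_abs_self (s - f u)
    linarith
  have hCne : ∃ u, u ∈ C := by
    refine ⟨fun y => (F x₀ y).toReal, x₀, fun y => ?_⟩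
    exact EReal.le_coe_toReal (hx₀ y)
  set S : ℝ := ∑ y : t, f (Pi.single y 1) with hS
  have hSpos : 0 < S := by
    refine lt_of_le_of_ne (Finset.sum_nonneg fun y _ => hlam y) fun h0 => ?_
    have hz : ∀ y : t, f (Pi.single y 1) = 0 := fun y =>
      (Finset.sum_eq_zero_iff_of_nonneg fun y _ => hlam y).1 h0.symm y (Finset.mem_univ _)
    have hf : ∀ u, f u = 0 := fun u => by rw [hsum]; simp [hz]
    obtain ⟨u, hu⟩ := hCne
    have h1 := hfC u hu
    have h2 := hfO (fun _ => α - 1) (fun _ => by linarith)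
    rw [hf] at h1 h2
    linarith
  -- Evaluate `f` at constant vectors in `O` approaching the corner `(α, …, α)`.
  have hsα : α * S ≤ s := by
    refine le_of_forall_pos_lt_add fun e he => ?_
    have h1 := hfO (fun _ => α - e / S) (fun _ => by
      have : 0 < e / S := div_pos he hSpos
      linarith)
    rw [hsum, ← Finset.mul_sum, ← hS, sub_mul, div_mul_cancel₀ _ hSpos.ne'] at h1
    linarith
  refine ⟨fun y => if hy : y ∈ t then f (Pi.single ⟨y, hy⟩ 1) / S else 0, fun y => ?_, ?_,
    fun x u hu => ?_⟩
  · dsimp only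
    split_ifs
    · exact div_nonneg (hlam _) hSpos.le
    · exact le_rfl
  · rw [← Finset.sum_coe_sort]
    simp only [Finset.coe_mem, dite_true, Subtype.coe_eta]
    rw [← Finset.sum_div, div_self hSpos.ne']
  · have h1 := hfC (fun y => u y) ⟨x, fun y => hu y y.2⟩
    rw [hsum] at h1
    rw [← Finset.sum_coe_sort]
    simp only [Finset.coe_mem, dite_true, Subtype.coe_eta]
    have : ∑ y : t, f (Pi.single y 1) / S * u y = (∑ y : t, u y * f (Pi.single y 1)) / S := by
      rw [Finset.sum_div]
      exact Finset.sum_congr rfl fun y _ => by ring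
    rw [this, le_div_iff₀ hSpos]
    linarith

variable [TopologicalSpace X]

/-- If `F · y₀` is inf-compact, then adding a small multiple of `F · y` keeps it bounded below. -/
theorem exists_add_mul_bddBelow {F : X → Y → EReal} (hbot : ∀ x y, F x y ≠ ⊥)
    (hlsc : ∀ y, LowerSemicontinuous fun x => F x y) (hconv : Convexlike F)
    {y₀ : Y} (hcomp : ∀ a : ℝ, IsCompact {x | F x y₀ ≤ a}) {x₀ : X} (hx₀ : ∀ y, F x₀ y ≠ ⊤)
    (y : Y) :
    ∃ δ : ℝ, 0 < δ ∧ ∃ L : ℝ, ∀ x, ∀ a₀ a₁ : ℝ, F x y₀ = a₀ → F x y = a₁ → L ≤ a₀ + δ * a₁ := by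
  lift F x₀ y₀ to ℝ using ⟨hx₀ y₀, hbot _ _⟩ with m₀ hm₀
  lift F x₀ y to ℝ using ⟨hx₀ y, hbot _ _⟩ with b₀ hb₀
  set K : Set X := {x | F x y₀ ≤ ((m₀ + 1 : ℝ) : EReal)} with hK
  have hKc : IsCompact K := hcomp _
  have hx₀K : x₀ ∈ K := by
    simp only [hK, mem_ofPred, ← hm₀]
    exact_mod_cast (by linarith : m₀ ≤ m₀ + 1)
  have bdd : ∀ y', ∃ m : ℝ, ∀ x ∈ K, (m : EReal) ≤ F x y' := by
    intro y'
    obtain ⟨x₁, hx₁, hmin⟩ := LowerSemicontinuousOn.exists_isMinOn ⟨x₀, hx₀K⟩ hKc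
      ((hlsc y').lowerSemicontinuousOn K)
    obtain ⟨m, -, hm⟩ := EReal.lt_iff_exists_real_btwn.1 (bot_lt_iff_ne_bot.2 (hbot x₁ y'))
    exact ⟨m, fun x hx => hm.le.trans (hmin hx)⟩
  obtain ⟨m, hm⟩ := bdd y₀
  obtain ⟨n, hn⟩ := bdd y
  -- Outside `K`, convexity along the segment from `x₀` lets `F · y` fall at most `M` times as fast
  -- as `F · y₀` rises, so the factor `1 / M` compensates.
  set M : ℝ := |n| + |b₀| + 1 with hM
  have hMpos : 0 < M := by positivity
  refine ⟨1 / M, by positivity, min m₀ (m - 1), fun x a₀ a₁ h₀ h₁ => ?_⟩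
  by_cases hx : x ∈ K
  · have e₀ := hm x hx
    have e₁ := hn x hx
    rw [h₀] at e₀
    rw [h₁] at e₁
    norm_cast at e₀ e₁
    have : -1 ≤ 1 / M * a₁ := by
      rw [div_mul_eq_mul_div, le_div_iff₀ hMpos]
      have := neg_abs_le n
      have := abs_nonneg b₀
      linarith
    exact (min_le_right _ _).trans (by linarith)
  · refine (min_le_left _ _).trans ?_
    have hx' : m₀ + 1 < a₀ := by
      have : ((m₀ + 1 : ℝ) : EReal) < F x y₀ := not_le.1 hx
      rw [h₀] at this
      exact_mod_cast this
    have hpos : 0 < a₀ - m₀ := by linarith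
    -- The weight of `x` is chosen so that `F z y₀ ≤ m₀ + 1`, which puts `z` in `K`, where the lower
    -- bound `n` is available.
    obtain ⟨z, hz⟩ := hconv x₀ x (1 - 1 / (a₀ - m₀)) (1 / (a₀ - m₀))
      (by rw [sub_pos, div_lt_one hpos]; linarith) (by positivity) (by ring)
    have hzK : z ∈ K := by
      have := hz y₀ m₀ a₀ hm₀.symm.le h₀.le
      refine this.trans (le_of_eq ?_)
      congr 1
      field_simp
      ring
    have key := (hn z hzK).trans (hz y b₀ a₁ hb₀.symm.le h₁.le)
    norm_cast at key
    have hs : 1 / (a₀ - m₀) ≤ 1 := by rw [div_le_one hpos]; linarith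
    have hs0 : 0 ≤ 1 / (a₀ - m₀) := by positivity
    have h2 : (1 - 1 / (a₀ - m₀)) * b₀ ≤ |b₀| := by
      calc _ ≤ (1 - 1 / (a₀ - m₀)) * |b₀| :=
            mul_le_mul_of_nonneg_left (le_abs_self _) (by linarith)
        _ ≤ 1 * |b₀| := mul_le_mul_of_nonneg_right (by linarith) (abs_nonneg _)
        _ = _ := one_mul _
    have h3 : -M ≤ 1 / (a₀ - m₀) * a₁ := by
      have := neg_abs_le n
      linarith
    have h4 : -M * (a₀ - m₀) ≤ a₁ := by
      rw [div_mul_eq_mul_div, one_mul, le_div_iff₀ hpos] at h3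
      exact h3
    have h5 : -(a₀ - m₀) ≤ 1 / M * a₁ := by
      rw [div_mul_eq_mul_div, le_div_iff₀ hMpos]
      linarith
    linarith

open Classical in
theorem exists_forall_mem_finset_le {F : X → Y → EReal} (hbot : ∀ x y, F x y ≠ ⊥)
    (hlsc : ∀ y, LowerSemicontinuous fun x => F x y) (hconv : Convexlike F)
    (hconc : Concavelike F)
    {y₀ : Y} (hcomp : ∀ a : ℝ, IsCompact {x | F x y₀ ≤ a}) {x₀ : X} (hx₀ : ∀ y, F x₀ y ≠ ⊤)
    {α : ℝ} (hα : ⨆ y, ⨅ x, F x y < α) (t : Finset Y) (hy₀ : y₀ ∈ t) :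
    ∃ x, ∀ y ∈ t, F x y ≤ α := by
  by_contra! hcon
  obtain ⟨w, hw, hw1, hwα⟩ := exists_weights_of_forall_exists_lt hconv hx₀ hcon
  choose δ hδ L hL using exists_add_mul_bddBelow hbot hlsc hconv hcomp hx₀
  obtain ⟨β, hvβ, hβα⟩ := EReal.lt_iff_exists_real_btwn.1 hα
  norm_cast at hβα
  -- The extra `t.card` at `y₀` supplies one copy of `F x y₀` for each `y ∈ t`, so the bounds `L y`
  -- add up to `Λ`.
  set k : Y → ℝ := fun y => δ y + if y = y₀ then (t.card : ℝ) else 0 with hk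
  have hkpos : ∀ y, 0 < k y := fun y => by
    simp only [hk]
    have := hδ y
    split_ifs <;> positivity
  set S := ∑ y ∈ t, k y with hS
  have hSpos : 0 < S := Finset.sum_pos (fun y _ => hkpos y) ⟨y₀, hy₀⟩
  set Λ := ∑ y ∈ t, L y with hΛ
  have hD : ∀ x, ∀ u : Y → ℝ, (∀ y ∈ t, F x y = u y) → Λ ≤ ∑ y ∈ t, k y * u y := by
    intro x u hu
    have h1 : Λ ≤ ∑ y ∈ t, (u y₀ + δ y * u y) :=
      Finset.sum_le_sum fun y hy => hL y x _ _ (hu y₀ hy₀) (hu y hy)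
    refine h1.trans (le_of_eq ?_)
    simp only [hk, add_mul, Finset.sum_add_distrib, ite_mul, zero_mul, Finset.sum_ite_eq', hy₀,
      if_true, Finset.sum_const, nsmul_eq_mul]
    ring
  -- Small enough that the perturbed average `(α + τ * Λ) / (1 + τ * S)` is still at least `β`.
  set τ : ℝ := (α - β) / (|β * S - Λ| + 1) with hτ
  have hτpos : 0 < τ := div_pos (by linarith) (by positivity)
  have hτβ : β * (1 + τ * S) ≤ α + τ * Λ := by
    have : τ * (β * S - Λ) ≤ α - β := by
      calc τ * (β * S - Λ) ≤ τ * (|β * S - Λ| + 1) :=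
            mul_le_mul_of_nonneg_left ((le_abs_self _).trans (by linarith)) hτpos.le
        _ = α - β := by rw [hτ]; field_simp
    linarith
  have hWpos : ∀ y, 0 < w y + τ * k y := fun y =>
    add_pos_of_nonneg_of_pos (hw y) (mul_pos hτpos (hkpos y))
  obtain ⟨y', hy'⟩ := hconc.exists_finset_mixture ⟨y₀, hy₀⟩ (fun y => w y + τ * k y) hWpos
  have hsumW : ∑ y ∈ t, (w y + τ * k y) = 1 + τ * S := by
    rw [Finset.sum_add_distrib, hw1, ← Finset.mul_sum]
  have hTpos : 0 < 1 + τ * S := by positivity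
  have hfin : ∀ x, (β : EReal) ≤ F x y' := by
    intro x
    by_cases hx : ∀ y ∈ t, F x y ≠ ⊤
    · have hu : ∀ y ∈ t, F x y = ((F x y).toReal : EReal) := fun y hy =>
        (EReal.coe_toReal (hx y hy) (hbot x y)).symm
      refine le_trans ?_ (hy' x (fun y => (F x y).toReal) fun y hy => (hu y hy).ge)
      rw [hsumW]
      norm_cast
      rw [le_div_iff₀ hTpos]
      refine hτβ.trans ?_
      have h1 := hwα x _ fun y hy => (hu y hy).le
      have h2 := mul_le_mul_of_nonneg_left (hD x _ hu) hτpos.le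
      have : ∑ y ∈ t, (w y + τ * k y) * (F x y).toReal
          = ∑ y ∈ t, w y * (F x y).toReal + τ * ∑ y ∈ t, k y * (F x y).toReal := by
        rw [Finset.mul_sum, ← Finset.sum_add_distrib]
        exact Finset.sum_congr rfl fun y _ => by ring
      rw [this]
      linarith
    · push Not at hx
      obtain ⟨z, hz, hztop⟩ := hx
      set R := ∑ y ∈ t, (w y + τ * k y) * (F x y).toReal with hR
      -- Since `F x z = ⊤`, the minorant at `z` is free; `c` makes the weighted average exactly `β`.
      -- This needs the weight at `z` to be positive.
      set c : ℝ := (β * (1 + τ * S) - R) / (w z + τ * k z) with hc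
      refine le_trans ?_ (hy' x (fun y => (F x y).toReal + if y = z then c else 0) fun y hy => ?_)
      · rw [hsumW]
        norm_cast
        rw [le_div_iff₀ hTpos]
        have : ∑ y ∈ t, (w y + τ * k y) * ((F x y).toReal + if y = z then c else 0)
            = R + (w z + τ * k z) * c := by
          simp only [mul_add (w _ + τ * k _), Finset.sum_add_distrib, mul_ite, mul_zero,
            Finset.sum_ite_eq', hz, if_true, hR]
        rw [this, hc, mul_div_cancel₀ _ (hWpos z).ne']
        linarith
      · by_cases hyz : y = z
        · subst hyz; rw [hztop]; exact le_top
        · simp only [hyz, if_false, add_zero]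
          exact EReal.coe_toReal_le (hbot x y)
  exact absurd (hvβ.trans_le ((le_iInf hfin).trans (le_iSup (fun y => ⨅ x, F x y) y')))
    (lt_irrefl _)

/-- A minimax theorem for functions with values in `(-∞, ∞]` that are lower semicontinuous and
convexlike in the first argument, concavelike in the second one, and inf-compact for one value of
the second argument. -/
theorem exists_iSup_le_iSup_iInf {F : X → Y → EReal} (hbot : ∀ x y, F x y ≠ ⊥)
    (hlsc : ∀ y, LowerSemicontinuous fun x => F x y) (hconv : Convexlike F)
    (hconc : Concavelike F)
    {y₀ : Y} (hcomp : ∀ a : ℝ, IsCompact {x | F x y₀ ≤ a}) {x₀ : X} (hx₀ : ⨆ y, F x₀ y < ⊤) :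
    ∃ x, ⨆ y, F x y ≤ ⨆ y, ⨅ x, F x y := by
  classical
  set v := ⨆ y, ⨅ x, F x y with hv
  have hx₀' : ∀ y, F x₀ y ≠ ⊤ := fun y =>
    ((le_iSup (fun y => F x₀ y) y).trans_lt hx₀).ne
  have hvtop : v < ⊤ := (iSup_mono fun y => iInf_le (fun x => F x y) x₀).trans_lt hx₀
  obtain ⟨α₀, hα₀, -⟩ := EReal.lt_iff_exists_real_btwn.1 hvtop
  have hne := (hcomp α₀).inter_iInter_nonempty
    (fun i : Y × {α : ℝ // v < α} => {x | F x i.1 ≤ (i.2 : ℝ)})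
    (fun i => (hlsc i.1).isClosed_preimage _) ?_
  · obtain ⟨x, -, hx⟩ := hne
    simp only [mem_iInter, mem_ofPred] at hx
    refine ⟨x, iSup_le fun y => EReal.le_of_forall_lt_iff_le.1 fun z hz => hx (y, ⟨z, hz⟩)⟩
  · intro s
    -- A finite set of constraints has a common level strictly above `v`; keeping it below `α₀` also
    -- places the solution in the compact set.
    have hmin : ∃ β : ℝ, v < β ∧ β ≤ α₀ ∧ ∀ i ∈ s, β ≤ i.2 := by
      induction s using Finset.induction_on with
      | empty => exact ⟨α₀, hα₀, le_rfl, by simp⟩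
      | insert i s _ ih =>
        obtain ⟨β, h1, h2, h3⟩ := ih
        refine ⟨min β i.2, ?_, (min_le_left _ _).trans h2, fun j hj => ?_⟩
        · rcases min_choice β i.2 with h | h
          · rw [h]; exact h1
          · rw [h]; exact i.2.2
        · rcases Finset.mem_insert.1 hj with rfl | hj
          · exact min_le_right _ _
          · exact (min_le_left _ _).trans (h3 j hj)
    obtain ⟨β, h1, h2, h3⟩ := hmin
    obtain ⟨x, hx⟩ := exists_forall_mem_finset_le hbot hlsc hconv hconc hcomp hx₀' h1
      (insert y₀ (s.image Prod.fst)) (Finset.mem_insert_self _ _)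
    refine ⟨x, (hx y₀ (Finset.mem_insert_self _ _)).trans (EReal.coe_le_coe_iff.2 h2), ?_⟩
    simp only [mem_iInter, mem_ofPred]
    exact fun i hi => (hx i.1 (Finset.mem_insert_of_mem (Finset.mem_image_of_mem _ hi))).trans
      (EReal.coe_le_coe_iff.2 (h3 i hi))

end Minimax

/-! ### Inequalities between positive and negative parts. -/

section Arithmetic

variable {A A₁ A₂ B B₁ B₂ : ℝ≥0∞} {a b u₁ u₂ : ℝ}

theorem coe_sub_coe_le_coe_iff (hB : B ≠ ∞) {u : ℝ} :
    (A : EReal) - (B : EReal) ≤ u ↔ A ≠ ∞ ∧ A.toReal ≤ u + B.toReal := by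
  lift B to ℝ≥0 using hB
  induction A with
  | top => simp
  | coe A =>
    have : ((A : ℝ≥0∞) : EReal) - ((B : ℝ≥0∞) : EReal) = (((A : ℝ) - B : ℝ) : EReal) := by
      push_cast; rfl
    rw [this, EReal.coe_le_coe_iff]
    simp

theorem coe_le_coe_sub_coe_iff (hB : B ≠ ∞) {u : ℝ} :
    (u : EReal) ≤ (A : EReal) - (B : EReal) ↔ A = ∞ ∨ u + B.toReal ≤ A.toReal := by
  lift B to ℝ≥0 using hB
  induction A with
  | top => simp
  | coe A =>
    have : ((A : ℝ≥0∞) : EReal) - ((B : ℝ≥0∞) : EReal) = (((A : ℝ) - B : ℝ) : EReal) := by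
      push_cast; rfl
    rw [this, EReal.coe_le_coe_iff]
    simp [le_sub_iff_add_le]

theorem sub_le_of_add_le_add (ha : 0 ≤ a) (hb : 0 ≤ b) (hB : B ≠ ∞) (hB₁ : B₁ ≠ ∞) (hB₂ : B₂ ≠ ∞)
    (h : A + (.ofReal a * B₁ + .ofReal b * B₂) ≤ B + (.ofReal a * A₁ + .ofReal b * A₂))
    (h₁ : (A₁ : EReal) - B₁ ≤ u₁) (h₂ : (A₂ : EReal) - B₂ ≤ u₂) :
    (A : EReal) - B ≤ ((a * u₁ + b * u₂ : ℝ) : EReal) := by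
  rw [coe_sub_coe_le_coe_iff hB₁] at h₁
  rw [coe_sub_coe_le_coe_iff hB₂] at h₂
  rw [coe_sub_coe_le_coe_iff hB]
  obtain ⟨hA₁, h₁⟩ := h₁
  obtain ⟨hA₂, h₂⟩ := h₂
  have hR : B + (.ofReal a * A₁ + .ofReal b * A₂) ≠ ∞ := by finiteness
  have hA : A ≠ ∞ := fun hA => by simp [hA] at h; simp_all
  refine ⟨hA, ?_⟩
  have h' := ENNReal.toReal_mono hR h
  rw [ENNReal.toReal_add hA (by finiteness), ENNReal.toReal_add hB (by finiteness),
    ENNReal.toReal_add (by finiteness) (by finiteness),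
    ENNReal.toReal_add (by finiteness) (by finiteness)] at h'
  simp only [ENNReal.toReal_mul, ENNReal.toReal_ofReal ha, ENNReal.toReal_ofReal hb] at h'
  nlinarith [mul_le_mul_of_nonneg_left h₁ ha, mul_le_mul_of_nonneg_left h₂ hb]

theorem le_sub_of_add_le_add (ha : 0 < a) (hb : 0 < b) (hB : B ≠ ∞) (hB₁ : B₁ ≠ ∞) (hB₂ : B₂ ≠ ∞)
    (h : B + (.ofReal a * A₁ + .ofReal b * A₂) ≤ A + (.ofReal a * B₁ + .ofReal b * B₂))
    (h₁ : (u₁ : EReal) ≤ A₁ - B₁) (h₂ : (u₂ : EReal) ≤ A₂ - B₂) :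
    ((a * u₁ + b * u₂ : ℝ) : EReal) ≤ A - B := by
  rw [coe_le_coe_sub_coe_iff hB₁] at h₁
  rw [coe_le_coe_sub_coe_iff hB₂] at h₂
  rw [coe_le_coe_sub_coe_iff hB]
  by_cases hA : A = ∞
  · exact .inl hA
  right
  have hR : A + (.ofReal a * B₁ + .ofReal b * B₂) ≠ ∞ := by finiteness
  have hL := ne_top_of_le_ne_top hR h
  have hA₁ : A₁ ≠ ∞ := by rintro rfl; simp [ENNReal.mul_top, ha] at hL
  have hA₂ : A₂ ≠ ∞ := by rintro rfl; simp [ENNReal.mul_top, hb] at hL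
  have h' := ENNReal.toReal_mono hR h
  rw [ENNReal.toReal_add hA (by finiteness), ENNReal.toReal_add hB (by finiteness),
    ENNReal.toReal_add (by finiteness) (by finiteness),
    ENNReal.toReal_add (by finiteness) (by finiteness)] at h'
  simp only [ENNReal.toReal_mul, ENNReal.toReal_ofReal ha.le, ENNReal.toReal_ofReal hb.le] at h'
  have h₁ := h₁.resolve_left hA₁
  have h₂ := h₂.resolve_left hA₂
  nlinarith [mul_le_mul_of_nonneg_left h₁ ha.le, mul_le_mul_of_nonneg_left h₂ hb.le]

/-- Moving every negative part to the opposite side removes subtraction, so the convexity inequality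
can be integrated in `ℝ≥0∞`. Subtraction returns afterwards through `sub_le_of_add_le_add` and
`le_sub_of_add_le_add`. -/
theorem toENNReal_add_le_of_le_add {H F G : EReal} (ha : 0 < a) (hb : 0 < b) (hF : F ≠ ⊥)
    (hG : G ≠ ⊥) (h : H ≤ a * F + b * G) :
    H.toENNReal + (.ofReal a * (-F).toENNReal + .ofReal b * (-G).toENNReal) ≤
      (-H).toENNReal + (.ofReal a * F.toENNReal + .ofReal b * G.toENNReal) := by
  induction F with
  | bot => exact absurd rfl hF
  | top => simp [ENNReal.mul_top, ha]
  | coe F =>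
  induction G with
  | bot => exact absurd rfl hG
  | top => simp [ENNReal.mul_top, hb]
  | coe G =>
  induction H with
  | bot => simp
  | top =>
    rw [top_le_iff] at h
    exact absurd h (by norm_cast; exact EReal.coe_ne_top _)
  | coe H =>
    norm_cast at h
    have e : ∀ x : ℝ, ENNReal.ofReal x = ENNReal.ofReal (max x 0) := fun x => by simp
    have key : ∀ x : ℝ, max x 0 - max (-x) 0 = x := fun x => by
      rcases le_total x 0 with hx | hx
      · rw [max_eq_right hx, max_eq_left (by linarith)]; ring
      · rw [max_eq_left hx, max_eq_right (by linarith)]; ring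
    have p : ∀ x : ℝ, 0 ≤ max x 0 := fun x => le_max_right _ _
    simp only [← EReal.coe_neg, EReal.real_coe_toENNReal]
    rw [e H, e (-F), e (-G), e (-H), e F, e G]
    rw [← ENNReal.ofReal_mul ha.le, ← ENNReal.ofReal_mul hb.le, ← ENNReal.ofReal_mul ha.le,
      ← ENNReal.ofReal_mul hb.le,
      ← ENNReal.ofReal_add (mul_nonneg ha.le (p _)) (mul_nonneg hb.le (p _)),
      ← ENNReal.ofReal_add (mul_nonneg ha.le (p _)) (mul_nonneg hb.le (p _)),
      ← ENNReal.ofReal_add (p _) (add_nonneg (mul_nonneg ha.le (p _)) (mul_nonneg hb.le (p _))),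
      ← ENNReal.ofReal_add (p _) (add_nonneg (mul_nonneg ha.le (p _)) (mul_nonneg hb.le (p _)))]
    refine ENNReal.ofReal_le_ofReal ?_
    have h1 := congrArg (a * ·) (key F)
    have h2 := congrArg (b * ·) (key G)
    have h3 := key H
    simp only [mul_sub] at h1 h2
    linarith

/-- This is `f = (f + M)⁺ - M - (-f - M)⁺` without subtraction: a truncated function minus its tail
below `-M`. -/
theorem toENNReal_add_add_toENNReal_neg (f : EReal) (M : ℝ≥0) :
    (f + M).toENNReal + (-f).toENNReal = f.toENNReal + M + (-f - M).toENNReal := by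
  induction f with
  | bot =>
    have : (⊤ : EReal) - ((M : ℝ≥0∞) : EReal) = ⊤ := EReal.top_sub_coe (M : ℝ)
    simp [this]
  | top => simp
  | coe f =>
    have h1 : (f : EReal) + ((M : ℝ≥0∞) : EReal) = ((f + M : ℝ) : EReal) := by push_cast; rfl
    have h2 : -(f : EReal) - ((M : ℝ≥0∞) : EReal) = ((-f - M : ℝ) : EReal) := by push_cast; rfl
    rw [h1, h2, ← EReal.coe_neg]
    simp only [EReal.real_coe_toENNReal]
    have hM : (M : ℝ≥0∞) = ENNReal.ofReal M := by simp
    have hM0 : (0 : ℝ) ≤ M := M.2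
    rw [hM]
    rcases le_total 0 f with hf | hf
    · rw [ENNReal.ofReal_of_nonpos (p := -f) (by linarith),
        ENNReal.ofReal_of_nonpos (p := -f - M) (by linarith), ENNReal.ofReal_add hf hM0]
    · rw [ENNReal.ofReal_of_nonpos hf]
      rcases le_total 0 (f + M) with h | h
      · rw [ENNReal.ofReal_of_nonpos (p := -f - M) (by linarith),
          ← ENNReal.ofReal_add h (by linarith)]
        simp
      · rw [ENNReal.ofReal_of_nonpos h, zero_add, zero_add,
          ← ENNReal.ofReal_add hM0 (by linarith)]
        congr 1; ring

end Arithmetic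

/-! ### Expectations, mixtures and convexity of the ambiguity set. -/

section Expectation

variable {Z : Type*} [MeasurableSpace Z]

theorem expect_neg {Q : ProbabilityMeasure Z} {f : Z → EReal}
    (hf : ∫⁻ z, (f z).toENNReal ∂(Q : Measure Z) ≠ ∞) :
    expect Q (fun z => -f z) = -expect Q f := by
  unfold expect
  rw [EReal.neg_sub (.inl (by simp)) (.inl (by simpa using hf)), sub_eq_add_neg, add_comm]
  simp

theorem expect_ne_bot {Q : ProbabilityMeasure Z} {f : Z → EReal}
    (hf : ∫⁻ z, (-f z).toENNReal ∂(Q : Measure Z) ≠ ∞) : expect Q f ≠ ⊥ := by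
  unfold expect
  rw [sub_eq_add_neg, Ne, EReal.add_eq_bot_iff]
  simp [hf]

theorem measurable_toENNReal_neg {f : Z → EReal} (hf : Measurable f) :
    Measurable fun z => (-f z).toENNReal := hf.neg.ereal_toENNReal

theorem lintegral_toENNReal_add_le {Q : ProbabilityMeasure Z} {H F G : Z → EReal}
    (hH : Measurable H) (hF : Measurable F) (hG : Measurable G) {a b : ℝ} (ha : 0 < a)
    (hb : 0 < b) (hFb : ∀ z, F z ≠ ⊥) (hGb : ∀ z, G z ≠ ⊥) (h : ∀ z, H z ≤ a * F z + b * G z) :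
    ∫⁻ z, (H z).toENNReal ∂(Q : Measure Z)
        + (.ofReal a * ∫⁻ z, (-F z).toENNReal ∂(Q : Measure Z)
          + .ofReal b * ∫⁻ z, (-G z).toENNReal ∂(Q : Measure Z)) ≤
      ∫⁻ z, (-H z).toENNReal ∂(Q : Measure Z)
        + (.ofReal a * ∫⁻ z, (F z).toENNReal ∂(Q : Measure Z)
          + .ofReal b * ∫⁻ z, (G z).toENNReal ∂(Q : Measure Z)) := by
  have hH' := hH.ereal_toENNReal
  have hF' := hF.ereal_toENNReal
  have hG' := hG.ereal_toENNReal
  have hHn := measurable_toENNReal_neg hH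
  have hFn := measurable_toENNReal_neg hF
  have hGn := measurable_toENNReal_neg hG
  have := lintegral_mono (μ := (Q : Measure Z)) fun z =>
    toENNReal_add_le_of_le_add ha hb (hFb z) (hGb z) (h z)
  rw [lintegral_add_left hH', lintegral_add_left (hFn.const_mul _),
    lintegral_const_mul _ hFn, lintegral_const_mul _ hGn, lintegral_add_left hHn,
    lintegral_add_left (hF'.const_mul _), lintegral_const_mul _ hF',
    lintegral_const_mul _ hG'] at this
  exact this

/-- The convex combination of two probability measures. -/
def mixture (a b : ℝ) (ha : 0 ≤ a) (hb : 0 ≤ b) (hab : a + b = 1) (Q₁ Q₂ : ProbabilityMeasure Z) :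
    ProbabilityMeasure Z :=
  ⟨ENNReal.ofReal a • (Q₁ : Measure Z) + ENNReal.ofReal b • (Q₂ : Measure Z), ⟨by
    simp [← ENNReal.ofReal_add ha hb, hab]⟩⟩

variable {a b : ℝ} {ha : 0 ≤ a} {hb : 0 ≤ b} {hab : a + b = 1}

theorem coe_mixture (Q₁ Q₂ : ProbabilityMeasure Z) :
    (mixture a b ha hb hab Q₁ Q₂ : Measure Z)
      = ENNReal.ofReal a • (Q₁ : Measure Z) + ENNReal.ofReal b • (Q₂ : Measure Z) := rfl

theorem lintegral_mixture (Q₁ Q₂ : ProbabilityMeasure Z) (f : Z → ℝ≥0∞) :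
    ∫⁻ z, f z ∂(mixture a b ha hb hab Q₁ Q₂ : Measure Z)
      = .ofReal a * ∫⁻ z, f z ∂(Q₁ : Measure Z) + .ofReal b * ∫⁻ z, f z ∂(Q₂ : Measure Z) := by
  rw [coe_mixture, lintegral_add_measure, lintegral_smul_measure, lintegral_smul_measure]
  rfl

theorem exists_coupling_of_otDiscrepancy_lt {c : Z → Z → ℝ≥0∞} {P P' : ProbabilityMeasure Z}
    {s : ℝ≥0∞} (h : otDiscrepancy c P P' < s) :
    ∃ π ∈ couplings P P', ∫⁻ x, c x.1 x.2 ∂(π : Measure (Z × Z)) < s := by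
  simp only [otDiscrepancy, iInf_lt_iff] at h
  obtain ⟨π, hπ, h⟩ := h
  exact ⟨π, hπ, h⟩

/-- Mixing near-optimal couplings mixes their first marginals, preserves the common second one and
averages the costs. -/
theorem mixture_mem_ambiguitySet {c : Z → Z → ℝ≥0∞} {ε : ℝ≥0} {Phat Q₁ Q₂ : ProbabilityMeasure Z}
    (h₁ : Q₁ ∈ ambiguitySet c ε Phat) (h₂ : Q₂ ∈ ambiguitySet c ε Phat) :
    mixture a b ha hb hab Q₁ Q₂ ∈ ambiguitySet c ε Phat := by
  refine le_of_forall_gt_imp_ge_of_dense (α := ℝ≥0∞) fun s hs => ?_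
  obtain ⟨π₁, ⟨hf₁, hs₁⟩, hc₁⟩ := exists_coupling_of_otDiscrepancy_lt (lt_of_le_of_lt h₁ hs)
  obtain ⟨π₂, ⟨hf₂, hs₂⟩, hc₂⟩ := exists_coupling_of_otDiscrepancy_lt (lt_of_le_of_lt h₂ hs)
  have h1 : ENNReal.ofReal a + ENNReal.ofReal b = 1 := by
    rw [← ENNReal.ofReal_add ha hb, hab, ENNReal.ofReal_one]
  refine (iInf₂_le (mixture a b ha hb hab π₁ π₂) ⟨?_, ?_⟩).trans ?_
  · rw [lintegral_mixture]
    calc _ ≤ ENNReal.ofReal a * s + ENNReal.ofReal b * s :=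
          add_le_add (mul_le_mul_right hc₁.le _) (mul_le_mul_right hc₂.le _)
      _ = s := by rw [← add_mul, h1, one_mul]
  · rw [coe_mixture, Measure.map_add _ _ measurable_fst, Measure.map_smul, Measure.map_smul, hf₁,
      hf₂, coe_mixture]
  · rw [coe_mixture, Measure.map_add _ _ measurable_snd, Measure.map_smul, Measure.map_smul, hs₁,
      hs₂, ← add_smul, h1, one_smul]

end Expectation

/-! ### Lower semicontinuity of expectations. -/

section Semicontinuity

variable {Z X : Type*} [MeasurableSpace Z] [TopologicalSpace X]

/-- Lower semicontinuity of expectations whose negative parts are locally uniformly integrable. -/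
theorem lowerSemicontinuousAt_expect {Q : X → ProbabilityMeasure Z} {f : X → Z → EReal}
    (hf : ∀ x, Measurable (f x))
    (hfin : ∀ x, ∫⁻ z, (-f x z).toENNReal ∂(Q x : Measure Z) ≠ ∞) {x₀ : X}
    (h : ∀ η : ℝ, 0 < η → ∃ M : ℝ≥0,
      (∀ᶠ x in 𝓝 x₀, ∫⁻ z, (-f x z - M).toENNReal ∂(Q x : Measure Z) ≤ ENNReal.ofReal η) ∧
      LowerSemicontinuousAt (fun x => ∫⁻ z, (f x z + M).toENNReal ∂(Q x : Measure Z)) x₀) :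
    LowerSemicontinuousAt (fun x => expect (Q x) (f x)) x₀ := by
  intro y hy
  obtain ⟨r, hyr, hr⟩ := EReal.lt_iff_exists_real_btwn.1 hy
  obtain ⟨r', hrr, hr'⟩ := EReal.lt_iff_exists_real_btwn.1 hr
  norm_cast at hrr
  -- Dropping the tail at `x₀` only helps; near `x₀` it costs at most `r' - r`, which is the gap
  -- available.
  obtain ⟨M, hM, hlsc⟩ := h (r' - r) (by linarith)
  have hid : ∀ x, ∫⁻ z, (f x z + M).toENNReal ∂(Q x : Measure Z)
      + ∫⁻ z, (-f x z).toENNReal ∂(Q x : Measure Z)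
      = ∫⁻ z, (f x z).toENNReal ∂(Q x : Measure Z) + M
        + ∫⁻ z, (-f x z - M).toENNReal ∂(Q x : Measure Z) := by
    intro x
    have hm := measurable_toENNReal_neg (hf x)
    rw [← lintegral_add_right _ hm]
    simp_rw [toENNReal_add_add_toENNReal_neg]
    rw [lintegral_add_left ((hf x).ereal_toENNReal.add_const _), lintegral_add_right _
      measurable_const]
    simp
  have hlsc' : LowerSemicontinuousAt
      (fun x => ((∫⁻ z, (f x z + M).toENNReal ∂(Q x : Measure Z) : ℝ≥0∞) : EReal)) x₀ :=
    continuous_coe_ennreal_ereal.continuousAt.comp_lowerSemicontinuousAt hlsc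
      (fun _ _ h => EReal.coe_ennreal_le_coe_ennreal_iff.2 h)
  have h0 : ((r' + M : ℝ) : EReal)
      < ((∫⁻ z, (f x₀ z + M).toENNReal ∂(Q x₀ : Measure Z) : ℝ≥0∞) : EReal) := by
    obtain ⟨s, hs, hs'⟩ := EReal.lt_iff_exists_real_btwn.1 hr'
    norm_cast at hs
    refine (EReal.coe_lt_coe_iff.2 (by linarith : r' + M < s + M)).trans_le ?_
    have hid₀ := hid x₀
    have hB := hfin x₀
    unfold expect at hs'
    generalize ∫⁻ z, (f x₀ z + M).toENNReal ∂(Q x₀ : Measure Z) = G at *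
    have h1 := (coe_le_coe_sub_coe_iff hB).1 hs'.le
    generalize ∫⁻ z, (-f x₀ z).toENNReal ∂(Q x₀ : Measure Z) = B at *
    generalize ∫⁻ z, (f x₀ z).toENNReal ∂(Q x₀ : Measure Z) = A at *
    generalize ∫⁻ z, (-f x₀ z - M).toENNReal ∂(Q x₀ : Measure Z) = T at *
    by_cases hG : G = ∞
    · simp [hG]
    have hfinL : G + B ≠ ∞ := by finiteness
    rw [hid₀] at hfinL
    have hA : A ≠ ∞ := by rintro rfl; simp at hfinL
    have hT : T ≠ ∞ := by rintro rfl; simp at hfinL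
    have h2 := congrArg ENNReal.toReal hid₀
    rw [ENNReal.toReal_add hG hB, ENNReal.toReal_add (by finiteness) hT,
      ENNReal.toReal_add hA (by finiteness)] at h2
    rw [← EReal.coe_ennreal_toReal hG, EReal.coe_le_coe_iff]
    have h3 := h1.resolve_left hA
    have h4 : 0 ≤ T.toReal := ENNReal.toReal_nonneg
    simp only [ENNReal.coe_toReal] at h2
    linarith
  filter_upwards [hM, hlsc' _ h0] with x hT hG
  refine hyr.trans_le ?_
  unfold expect
  rw [coe_le_coe_sub_coe_iff (hfin x)]
  have hid₀ := hid x
  have hB := hfin x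
  generalize ∫⁻ z, (f x z + M).toENNReal ∂(Q x : Measure Z) = G at *
  generalize ∫⁻ z, (-f x z).toENNReal ∂(Q x : Measure Z) = B at *
  generalize ∫⁻ z, (f x z).toENNReal ∂(Q x : Measure Z) = A at *
  generalize ∫⁻ z, (-f x z - M).toENNReal ∂(Q x : Measure Z) = T at *
  by_cases hA : A = ∞
  · exact .inl hA
  right
  have hT' : T ≠ ∞ := ne_top_of_le_ne_top ENNReal.ofReal_ne_top hT
  have hGfin : G ≠ ∞ := by
    have : G + B ≠ ∞ := by rw [hid₀]; finiteness
    rintro rfl; simp at this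
  have h2 := congrArg ENNReal.toReal hid₀
  rw [ENNReal.toReal_add hGfin hB, ENNReal.toReal_add (by finiteness) hT',
    ENNReal.toReal_add hA (by finiteness)] at h2
  rw [gt_iff_lt, ← EReal.coe_ennreal_toReal hGfin, EReal.coe_lt_coe_iff] at hG
  have h4 := ENNReal.toReal_mono ENNReal.ofReal_ne_top hT
  rw [ENNReal.toReal_ofReal (by linarith)] at h4
  simp only [ENNReal.coe_toReal] at h2
  linarith

/-- Fatou's lemma along the neighbourhood filter, which is countably generated. -/
theorem lowerSemicontinuousAt_lintegral [FirstCountableTopology X] {μ : Measure Z}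
    {g : X → Z → ℝ≥0∞} (hg : ∀ x, Measurable (g x)) {x₀ : X}
    (h : ∀ z, LowerSemicontinuousAt (fun x => g x z) x₀) :
    LowerSemicontinuousAt (fun x => ∫⁻ z, g x z ∂μ) x₀ := by
  rw [lowerSemicontinuousAt_iff_le_liminf]
  exact (lintegral_mono fun z => lowerSemicontinuousAt_iff_le_liminf.1 (h z)).trans
    (lintegral_liminf_le hg)

end Semicontinuity

/-! ### Semicontinuity of integrals in the weak topology. -/

section WeakTopology

variable {Z : Type*} [MeasurableSpace Z] [MetricSpace Z] [SecondCountableTopology Z] [BorelSpace Z]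

/-- By the layer-cake formula the integral is `∫ μ {g > t} dt`. Each `{g > t}` is open, so the
portmanteau theorem gives semicontinuity for each `t`, and Fatou's lemma integrates it. -/
theorem lowerSemicontinuous_lintegral_ofReal {g : Z → ℝ} (hg : LowerSemicontinuous g)
    (hg0 : ∀ z, 0 ≤ g z) :
    LowerSemicontinuous fun μ : ProbabilityMeasure Z =>
      ∫⁻ z, ENNReal.ofReal (g z) ∂(μ : Measure Z) := by
  intro μ
  have hm : Measurable g := hg.measurable
  simp_rw [lintegral_eq_lintegral_meas_lt _ (Filter.Eventually.of_forall hg0) hm.aemeasurable]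
  refine lowerSemicontinuousAt_lintegral (fun ν => ?_) fun t => ?_
  · exact Antitone.measurable fun s t hst => measure_mono fun z hz => lt_of_le_of_lt hst hz
  · rw [lowerSemicontinuousAt_iff_le_liminf]
    exact ProbabilityMeasure.le_liminf_measure_open_of_tendsto Filter.tendsto_id
      (hg.isOpen_preimage t)

/-- The integral of a nonnegative lower semicontinuous function is weakly lower semicontinuous. -/
theorem lowerSemicontinuous_lintegral {g : Z → ℝ≥0∞} (hg : LowerSemicontinuous g) :
    LowerSemicontinuous fun μ : ProbabilityMeasure Z => ∫⁻ z, g z ∂(μ : Measure Z) := by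
  -- Truncation at `n` reduces to real values; monotone convergence recovers `g`, and a supremum of
  -- lower semicontinuous functions is lower semicontinuous.
  have hlsc : ∀ n : ℕ, LowerSemicontinuous fun z => (min (g z) n).toReal := by
    intro n z y hy
    rcases lt_or_ge y 0 with h0 | h0
    · exact Filter.Eventually.of_forall fun z => h0.trans_le ENNReal.toReal_nonneg
    have hfin : ∀ z, min (g z) n ≠ ∞ := fun z => ne_top_of_le_ne_top (by simp) (min_le_right _ _)
    have key : ∀ z, y < (min (g z) n).toReal ↔ ENNReal.ofReal y < g z ∧ ENNReal.ofReal y < n := by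
      intro z
      rw [← lt_min_iff, ENNReal.ofReal_lt_iff_lt_toReal h0 (hfin z)]
    have hy' := (key z).1 hy
    filter_upwards [hg z _ hy'.1] with w hw
    exact (key w).2 ⟨hw, hy'.2⟩
  have hsup : ∀ z, g z = ⨆ n : ℕ, ENNReal.ofReal (min (g z) n).toReal := by
    intro z
    have : ∀ n : ℕ, ENNReal.ofReal (min (g z) n).toReal = min (g z) n := fun n =>
      ENNReal.ofReal_toReal (ne_top_of_le_ne_top (by simp) (min_le_right _ _))
    simp_rw [this]
    rw [← inf_iSup_eq (g z) (fun n : ℕ => (n : ℝ≥0∞)), ENNReal.iSup_natCast, inf_top_eq]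
  have : (fun μ : ProbabilityMeasure Z => ∫⁻ z, g z ∂(μ : Measure Z))
      = fun μ : ProbabilityMeasure Z =>
        ⨆ n : ℕ, ∫⁻ z, ENNReal.ofReal (min (g z) n).toReal ∂(μ : Measure Z) := by
    ext μ
    conv_lhs => enter [2, z]; rw [hsup z]
    rw [lintegral_iSup fun n => (hlsc n).measurable.ennreal_ofReal]
    intro m n hmn z
    refine ENNReal.ofReal_le_ofReal (ENNReal.toReal_mono
      (ne_top_of_le_ne_top (by simp) (min_le_right _ _)) ?_)
    exact min_le_min le_rfl (by exact_mod_cast hmn)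
  rw [this]
  exact lowerSemicontinuous_iSup fun n =>
    lowerSemicontinuous_lintegral_ofReal (hlsc n) fun z => ENNReal.toReal_nonneg

end WeakTopology

/-! ### Moment bounds and uniformly small upper tails. -/

section Moments

variable {Z : Type*} {c : Z → Z → ℝ≥0∞} {d : Z → Z → ℝ} {p : ℕ}

/-- The metric `d` may be unrelated to the topology, but its balls are compact, hence closed. -/
theorem CostLowerBound.measurable_dist [TopologicalSpace Z] [T2Space Z] [MeasurableSpace Z]
    [BorelSpace Z] (h : CostLowerBound c d p) (z₁ : Z) : Measurable fun z => d z z₁ :=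
  measurable_of_Iic fun t => (h.2.1 z₁ t).isClosed.measurableSet

theorem add_add_pow_le {x y k : ℝ} (hx : 0 ≤ x) (hy : 0 ≤ y) (hk : 0 ≤ k) (p : ℕ) :
    (x + y + k) ^ p ≤ 3 ^ p * (x ^ p + y ^ p + k ^ p) := by
  have h : x + y + k ≤ 3 * max (max x y) k := by
    have h1 := le_max_left (max x y) k
    have h2 := le_max_right (max x y) k
    have h3 := le_max_left x y
    have h4 := le_max_right x y
    linarith
  calc (x + y + k) ^ p ≤ (3 * max (max x y) k) ^ p := pow_le_pow_left₀ (by positivity) h p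
    _ = 3 ^ p * max (max x y) k ^ p := mul_pow _ _ _
    _ ≤ _ := by
      refine mul_le_mul_of_nonneg_left ?_ (by positivity)
      have h1 := pow_nonneg hx p
      have h2 := pow_nonneg hy p
      have h3 := pow_nonneg hk p
      rcases max_choice (max x y) k with h | h <;> rw [h]
      · rcases max_choice x y with h | h <;> rw [h] <;> linarith
      · linarith

theorem CostLowerBound.ofReal_dist_pow_le [TopologicalSpace Z] (h : CostLowerBound c d p)
    (z w z₀ z₁ : Z) :
    ENNReal.ofReal (d z z₁ ^ p) ≤
      ENNReal.ofReal (3 ^ p) * (c z w + c w z₀ + ENNReal.ofReal (d z₀ z₁ ^ p)) := by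
  obtain ⟨hd, -, -, hc⟩ := h
  have h1 : d z z₁ ≤ d z w + d w z₀ + d z₀ z₁ := by
    have := hd.triangle z w z₁
    have := hd.triangle w z₀ z₁
    linarith
  have h2 := (pow_le_pow_left₀ (hd.nonneg _ _) h1 p).trans
    (add_add_pow_le (hd.nonneg z w) (hd.nonneg w z₀) (hd.nonneg z₀ z₁) p)
  refine (ENNReal.ofReal_le_ofReal h2).trans ?_
  have hp : ∀ x y, 0 ≤ d x y ^ p := fun x y => pow_nonneg (hd.nonneg x y) p
  rw [ENNReal.ofReal_mul (by positivity), ENNReal.ofReal_add (add_nonneg (hp _ _) (hp _ _)) (hp _ _),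
    ENNReal.ofReal_add (hp _ _) (hp _ _)]
  gcongr
  · exact hc z w
  · exact hc w z₀

variable [TopologicalSpace Z] [MeasurableSpace Z]

/-- The `p`-th moments of the first marginals of couplings of bounded cost are bounded. -/
theorem exists_moment_bound (hc : Measurable fun x : Z × Z => c x.1 x.2)
    {Phat : ProbabilityMeasure Z} (hint : CostIntegrable c Phat) (h : CostLowerBound c d p)
    (s : ℝ≥0) (z₁ : Z) :
    ∃ C : ℝ≥0, ∀ π : ProbabilityMeasure (Z × Z),
      (π : Measure (Z × Z)).map Prod.snd = (Phat : Measure Z) →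
      ∫⁻ x, c x.1 x.2 ∂(π : Measure (Z × Z)) ≤ s →
      ∫⁻ z, ENNReal.ofReal (d z z₁ ^ p) ∂((π : Measure (Z × Z)).map Prod.fst) ≤ C := by
  obtain ⟨z₀, C₀, hC₀⟩ := hint
  set C : ℝ≥0∞ := ENNReal.ofReal (3 ^ p) * (s + C₀ + ENNReal.ofReal (d z₀ z₁ ^ p)) with hC
  have hCfin : C ≠ ∞ := by finiteness
  refine ⟨C.toNNReal, fun π hsnd hcost => ?_⟩
  rw [ENNReal.coe_toNNReal hCfin]
  have hc₀ : Measurable fun w => c w z₀ := hc.comp (measurable_id.prodMk measurable_const)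
  have hw : ∫⁻ x, c x.2 z₀ ∂(π : Measure (Z × Z)) ≤ C₀ := by
    rw [← hsnd, lintegral_map hc₀ measurable_snd] at hC₀
    exact hC₀
  calc _ ≤ ∫⁻ x, ENNReal.ofReal (d x.1 z₁ ^ p) ∂(π : Measure (Z × Z)) :=
        lintegral_map_le (fun z => ENNReal.ofReal (d z z₁ ^ p)) Prod.fst
    _ ≤ ∫⁻ x, ENNReal.ofReal (3 ^ p) * (c x.1 x.2 + c x.2 z₀ + ENNReal.ofReal (d z₀ z₁ ^ p))
          ∂(π : Measure (Z × Z)) := lintegral_mono fun x => h.ofReal_dist_pow_le _ _ _ _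
    _ = ENNReal.ofReal (3 ^ p) * (∫⁻ x, c x.1 x.2 ∂(π : Measure (Z × Z))
          + ∫⁻ x, c x.2 z₀ ∂(π : Measure (Z × Z)) + ENNReal.ofReal (d z₀ z₁ ^ p)) := by
      rw [lintegral_const_mul' _ _ ENNReal.ofReal_ne_top, lintegral_add_right _ measurable_const,
        lintegral_add_left hc]
      simp
    _ ≤ C := by rw [hC]; gcongr

theorem exists_moment_bound_ambiguitySet (hc : Measurable fun x : Z × Z => c x.1 x.2)
    {Phat : ProbabilityMeasure Z} (hint : CostIntegrable c Phat) (h : CostLowerBound c d p)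
    (ε : ℝ≥0) (z₁ : Z) :
    ∃ C : ℝ≥0, ∀ Q ∈ ambiguitySet c ε Phat,
      ∫⁻ z, ENNReal.ofReal (d z z₁ ^ p) ∂(Q : Measure Z) ≤ C := by
  obtain ⟨C, hC⟩ := exists_moment_bound hc hint h (ε + 1) z₁
  refine ⟨C, fun Q hQ => ?_⟩
  -- The infimum over couplings is not known to be attained, so some slack above `ε` is spent.
  have hlt : otDiscrepancy c Q Phat < ((ε + 1 : ℝ≥0) : ℝ≥0∞) :=
    lt_of_le_of_lt hQ (by exact_mod_cast lt_add_one ε)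
  obtain ⟨π, ⟨h1, h2⟩, h3⟩ := exists_coupling_of_otDiscrepancy_lt hlt
  have := hC π h2 h3.le
  rwa [h1] at this

theorem exists_mul_one_add_rpow_le {g r : ℝ} (hg : 0 < g) (hr : 0 < r) {p : ℕ} (hrp : r < p)
    {η : ℝ} (hη : 0 < η) :
    ∃ M : ℝ≥0, ∀ s : ℝ, 0 ≤ s → g * (1 + s ^ r) ≤ M + η * s ^ p := by
  -- From `S` on, `η * s ^ p` dominates `g * s ^ r`; before `S`, the left side is at most its value
  -- at `S`.
  set S : ℝ := max 1 ((g / η) ^ (1 / (p - r))) with hS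
  have hS1 : 1 ≤ S := le_max_left _ _
  have hpr : 0 < (p : ℝ) - r := by linarith
  have hSp : g ≤ η * S ^ ((p : ℝ) - r) := by
    have : g / η ≤ S ^ ((p : ℝ) - r) := by
      calc g / η = ((g / η) ^ (1 / ((p : ℝ) - r))) ^ ((p : ℝ) - r) := by
            rw [← Real.rpow_mul (by positivity), one_div_mul_cancel hpr.ne', Real.rpow_one]
        _ ≤ _ := Real.rpow_le_rpow (by positivity) (le_max_right _ _) hpr.le
    rwa [div_le_iff₀ hη, mul_comm] at this
  refine ⟨(g * (1 + S ^ r)).toNNReal, fun s hs => ?_⟩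
  rw [Real.coe_toNNReal _ (by positivity)]
  rcases le_total s S with h | h
  · have h1 : s ^ r ≤ S ^ r := Real.rpow_le_rpow hs h hr.le
    have h2 : 0 ≤ η * s ^ p := by positivity
    nlinarith
  · have hs1 : 0 < s := by linarith
    have h1 : S ^ ((p : ℝ) - r) ≤ s ^ ((p : ℝ) - r) :=
      Real.rpow_le_rpow (by linarith) h hpr.le
    have h2 : s ^ p = s ^ ((p : ℝ) - r) * s ^ r := by
      rw [← Real.rpow_add hs1, sub_add_cancel, Real.rpow_natCast]
    have h3 : g * s ^ r ≤ η * s ^ p := by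
      rw [h2, ← mul_assoc]
      refine mul_le_mul_of_nonneg_right (hSp.trans ?_) (by positivity)
      exact mul_le_mul_of_nonneg_left h1 hη.le
    have h4 : 0 ≤ g * S ^ r := by positivity
    linarith

/-- Losses of slower growth than the cost have uniformly small upper tails on the ambiguity set. -/
theorem exists_tail_bound (hc : Measurable fun x : Z × Z => c x.1 x.2)
    {Phat : ProbabilityMeasure Z} (hint : CostIntegrable c Phat) (h : CostLowerBound c d p)
    (ε : ℝ≥0) {f : Z → EReal} {g r : ℝ} {z₁ : Z} (hg : 0 < g) (hr : 0 < r) (hrp : r < p)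
    (hf : ∀ z, f z ≤ ((g * (1 + d z z₁ ^ r) : ℝ) : EReal)) {η : ℝ} (hη : 0 < η) :
    ∃ M : ℝ≥0, ∀ Q ∈ ambiguitySet c ε Phat,
      ∫⁻ z, (f z - M).toENNReal ∂(Q : Measure Z) ≤ ENNReal.ofReal η := by
  obtain ⟨C, hC⟩ := exists_moment_bound_ambiguitySet hc hint h ε z₁
  -- The `+ 1` only avoids division by zero.
  have hη' : 0 < η / (C + 1) := by positivity
  obtain ⟨M, hM⟩ := exists_mul_one_add_rpow_le hg hr hrp hη'
  refine ⟨M, fun Q hQ => ?_⟩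
  have hpt : ∀ z, (f z - M).toENNReal
      ≤ ENNReal.ofReal (η / (C + 1)) * ENNReal.ofReal (d z z₁ ^ p) := by
    intro z
    rw [← ENNReal.ofReal_mul hη'.le, ← EReal.real_coe_toENNReal]
    refine EReal.toENNReal_le_toENNReal ?_
    refine (EReal.sub_le_sub (hf z) le_rfl).trans ?_
    have e : ((M : ℝ≥0∞) : EReal) = ((M : ℝ) : EReal) := rfl
    rw [e, ← EReal.coe_sub, EReal.coe_le_coe_iff]
    have := hM (d z z₁) (h.1.nonneg _ _)
    linarith
  calc _ ≤ ∫⁻ z, ENNReal.ofReal (η / (C + 1)) * ENNReal.ofReal (d z z₁ ^ p) ∂(Q : Measure Z) :=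
        lintegral_mono hpt
    _ = ENNReal.ofReal (η / (C + 1)) * ∫⁻ z, ENNReal.ofReal (d z z₁ ^ p) ∂(Q : Measure Z) :=
        lintegral_const_mul' _ _ ENNReal.ofReal_ne_top
    _ ≤ ENNReal.ofReal (η / (C + 1)) * C := by gcongr; exact hC Q hQ
    _ ≤ ENNReal.ofReal η := by
      rw [← ENNReal.ofReal_coe_nnreal, ← ENNReal.ofReal_mul hη'.le]
      refine ENNReal.ofReal_le_ofReal ?_
      rw [div_mul_eq_mul_div, div_le_iff₀ (by positivity)]
      nlinarith [C.2]

theorem lintegral_toENNReal_ne_top (hc : Measurable fun x : Z × Z => c x.1 x.2)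
    {Phat : ProbabilityMeasure Z} (hint : CostIntegrable c Phat) (h : CostLowerBound c d p)
    {ε : ℝ≥0} {f : Z → EReal} {g r : ℝ} {z₁ : Z} (hg : 0 < g) (hr : 0 < r) (hrp : r < p)
    (hf : ∀ z, f z ≤ ((g * (1 + d z z₁ ^ r) : ℝ) : EReal)) {Q : ProbabilityMeasure Z}
    (hQ : Q ∈ ambiguitySet c ε Phat) :
    ∫⁻ z, (f z).toENNReal ∂(Q : Measure Z) ≠ ∞ := by
  obtain ⟨M, hM⟩ := exists_tail_bound hc hint h ε hg hr hrp hf one_pos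
  have hle : ∀ z, (f z).toENNReal ≤ (f z - M).toENNReal + M := by
    intro z
    have e : ((M : ℝ≥0∞) : EReal) = ((M : ℝ) : EReal) := rfl
    have h1 : f z = (f z - M) + M := by rw [e, EReal.sub_add_cancel]
    calc (f z).toENNReal = ((f z - M) + M).toENNReal := by rw [← h1]
      _ ≤ (f z - M).toENNReal + (M : EReal).toENNReal := EReal.toENNReal_add_le
      _ = _ := by rw [EReal.toENNReal_coe]
  refine ne_top_of_le_ne_top ?_ (lintegral_mono hle)
  rw [lintegral_add_right _ measurable_const]
  have := ((hM Q hQ).trans_lt ENNReal.ofReal_lt_top).ne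
  simpa using this

end Moments

/-! ### Weak compactness of the ambiguity set. -/

section Compactness

variable {Z : Type*} [MeasurableSpace Z] [MetricSpace Z] [SecondCountableTopology Z]
  [BorelSpace Z] {c : Z → Z → ℝ≥0∞} {d : Z → Z → ℝ} {p : ℕ}

/-- The probability measures on `Z × Z` with second marginal `Phat` and cost at most `s`. -/
def boundedPlans (c : Z → Z → ℝ≥0∞) (Phat : ProbabilityMeasure Z) (s : ℝ≥0) :
    Set (ProbabilityMeasure (Z × Z)) :=
  {π | (π : Measure (Z × Z)).map Prod.snd = (Phat : Measure Z) ∧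
    ∫⁻ x, c x.1 x.2 ∂(π : Measure (Z × Z)) ≤ s}

theorem isClosed_boundedPlans (hlsc : LowerSemicontinuous fun x : Z × Z => c x.1 x.2)
    (Phat : ProbabilityMeasure Z) (s : ℝ≥0) : IsClosed (boundedPlans c Phat s) := by
  have h1 : IsClosed {π : ProbabilityMeasure (Z × Z) |
      π.map (continuous_snd (X := Z) (Y := Z)).measurable.aemeasurable = Phat} :=
    isClosed_singleton.preimage (ProbabilityMeasure.continuous_map continuous_snd)
  have h2 := (lowerSemicontinuous_lintegral hlsc).isClosed_preimage (s : ℝ≥0∞)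
  convert h1.inter h2 using 1
  ext π
  refine and_congr ?_ Iff.rfl
  exact Subtype.coe_inj (a := π.map (continuous_snd (X := Z) (Y := Z)).measurable.aemeasurable)

/-- Intersecting over all levels `s > ε` replaces the existence of an optimal coupling: the
ambiguity set becomes an intersection of continuous images of compact sets of plans. -/
theorem ambiguitySet_eq_iInter (c : Z → Z → ℝ≥0∞) (ε : ℝ≥0) (Phat : ProbabilityMeasure Z) :
    ambiguitySet c ε Phat = ⋂ s : {s : ℝ≥0 // ε < s},
      (fun π : ProbabilityMeasure (Z × Z) =>
        π.map (continuous_fst (X := Z) (Y := Z)).measurable.aemeasurable) ''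
          boundedPlans c Phat s := by
  ext Q
  simp only [mem_iInter]
  constructor
  · rintro hQ ⟨s, hs⟩
    obtain ⟨π, ⟨h1, h2⟩, h3⟩ := exists_coupling_of_otDiscrepancy_lt
      (lt_of_le_of_lt hQ (by exact_mod_cast hs : (ε : ℝ≥0∞) < s))
    exact ⟨π, ⟨h2, h3.le⟩, Subtype.ext h1⟩
  · intro hQ
    refine le_of_forall_gt_imp_ge_of_dense (α := ℝ≥0∞) fun s hs => ?_
    obtain ⟨s', hs', hs''⟩ := ENNReal.lt_iff_exists_nnreal_btwn.1 hs
    obtain ⟨π, ⟨h2, h3⟩, h1⟩ := hQ ⟨s', by exact_mod_cast hs'⟩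
    refine (iInf₂_le π ⟨?_, h2⟩).trans (h3.trans hs''.le)
    exact congrArg Subtype.val h1

variable [CompleteSpace Z]

/-- Tightness is checked on marginals: the first by Markov's inequality on the compact `d`-balls,
the second because it is the single measure `Phat`. -/
theorem isTightMeasureSet_boundedPlans (hc : Measurable fun x : Z × Z => c x.1 x.2)
    {Phat : ProbabilityMeasure Z} (hint : CostIntegrable c Phat) (h : CostLowerBound c d p)
    (s : ℝ≥0) :
    IsTightMeasureSet {((π : ProbabilityMeasure (Z × Z)) : Measure (Z × Z)) |
      π ∈ boundedPlans c Phat s} := by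
  refine IsTightMeasureSet.prodMk ?_ ?_
  · obtain ⟨z₁, -⟩ := id hint
    obtain ⟨C, hC⟩ := exists_moment_bound hc hint h s z₁
    rw [isTightMeasureSet_iff_exists_isCompact_measure_compl_le]
    intro η hη
    -- With `t ≥ 1` one has `t ≤ t ^ p`, so leaving the ball of radius `t` forces `d ^ p ≥ t`, and
    -- Markov's inequality applies at level `t`.
    obtain ⟨t, ht⟩ : ∃ t : ℝ≥0, 1 ≤ t ∧ (C : ℝ≥0∞) ≤ η * t := by
      rcases eq_or_ne η ∞ with rfl | hη'
      · exact ⟨1, le_rfl, by simp⟩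
      lift η to ℝ≥0 using hη'
      norm_cast at hη
      refine ⟨max 1 (C / η), le_max_left _ _, ?_⟩
      norm_cast
      calc C = η * (C / η) := by rw [mul_div_cancel₀ _ hη.ne']
        _ ≤ _ := by gcongr; exact le_max_right _ _
    refine ⟨{z | d z z₁ ≤ t}, h.2.1 _ _, ?_⟩
    rintro _ ⟨_, ⟨π, ⟨hπ, hcost⟩, rfl⟩, rfl⟩
    have hm : Measurable fun z => ENNReal.ofReal (d z z₁ ^ p) :=
      ((h.measurable_dist z₁).pow_const p).ennreal_ofReal
    have h1 := (mul_meas_ge_le_lintegral (μ := (π : Measure (Z × Z)).map Prod.fst) hm t).trans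
      (hC π hπ hcost)
    have hsub : {z | d z z₁ ≤ t}ᶜ ⊆ {z | (t : ℝ≥0∞) ≤ ENNReal.ofReal (d z z₁ ^ p)} := by
      intro z hz
      have hz : (t : ℝ) < d z z₁ := not_le.1 hz
      have ht1 : (1 : ℝ) ≤ t := by exact_mod_cast ht.1
      rw [mem_ofPred, ← ENNReal.ofReal_coe_nnreal]
      refine ENNReal.ofReal_le_ofReal (hz.le.trans ?_)
      exact le_self_pow₀ (by linarith) (by have := h.2.2.1; omega)
    refine (measure_mono hsub).trans ?_
    have ht0 : (t : ℝ≥0∞) ≠ 0 := by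
      have := ht.1
      exact_mod_cast (zero_lt_one.trans_le this).ne'
    have h2 := h1.trans ht.2
    rw [mul_comm] at h2
    exact (ENNReal.mul_le_mul_iff_left ht0 ENNReal.coe_ne_top).1 h2
  · refine (isTightMeasureSet_singleton (μ := (Phat : Measure Z))).subset ?_
    rintro _ ⟨_, ⟨π, ⟨hπ, -⟩, rfl⟩, rfl⟩
    exact hπ

theorem isCompact_boundedPlans (hlsc : LowerSemicontinuous fun x : Z × Z => c x.1 x.2)
    {Phat : ProbabilityMeasure Z} (hint : CostIntegrable c Phat) (h : CostLowerBound c d p)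
    (s : ℝ≥0) : IsCompact (boundedPlans c Phat s) := by
  rw [← (isClosed_boundedPlans hlsc Phat s).closure_eq]
  exact isCompact_closure_of_isTightMeasureSet
    (isTightMeasureSet_boundedPlans hlsc.measurable hint h s)

theorem isCompact_ambiguitySet (hlsc : LowerSemicontinuous fun x : Z × Z => c x.1 x.2)
    {Phat : ProbabilityMeasure Z} (hint : CostIntegrable c Phat) (h : CostLowerBound c d p)
    (ε : ℝ≥0) : IsCompact (ambiguitySet c ε Phat) := by
  rw [ambiguitySet_eq_iInter]
  have hcomp : ∀ s : {s : ℝ≥0 // ε < s}, IsCompact ((fun π : ProbabilityMeasure (Z × Z) =>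
      π.map (continuous_fst (X := Z) (Y := Z)).measurable.aemeasurable) ''
        boundedPlans c Phat s) := fun s =>
    (isCompact_boundedPlans hlsc hint h s).image (ProbabilityMeasure.continuous_map continuous_fst)
  exact (hcomp ⟨ε + 1, lt_add_one ε⟩).of_isClosed_subset
    (isClosed_iInter fun s => (hcomp s).isClosed) (iInter_subset _ _)

end Compactness

/-! ### Truncations and negative parts of the loss. -/

section TruncatedLoss

theorem continuous_toENNReal_add_coe (M : ℝ≥0) :
    Continuous fun x : EReal => (x + M).toENNReal := by
  refine EReal.continuous_toENNReal.comp (continuous_iff_continuousAt.2 fun x => ?_)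
  have h : ContinuousAt (fun p : EReal × EReal => p.1 + p.2) (x, (M : EReal)) :=
    EReal.continuousAt_add (.inr (by simp)) (.inr (by simp))
  exact h.comp (f := fun x : EReal => (x, (M : EReal))) (by fun_prop)

theorem monotone_toENNReal_add_coe (M : ℝ≥0) : Monotone fun x : EReal => (x + M).toENNReal :=
  fun _ _ h => EReal.toENNReal_le_toENNReal (add_le_add h le_rfl)

theorem toENNReal_neg_eq_enorm {x : EReal} (hx : x ≠ ⊥) :
    (-x).toENNReal = ‖(-min 0 x).toReal‖ₑ := by
  induction x with
  | bot => exact absurd rfl hx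
  | top => simp
  | coe x =>
    have : -min 0 (x : EReal) = ((max 0 (-x) : ℝ) : EReal) := by
      rcases le_total 0 x with h | h
      · rw [min_eq_left (by exact_mod_cast h), max_eq_left (by linarith)]; simp
      · rw [min_eq_right (by exact_mod_cast h), max_eq_right (by linarith)]; simp
    rw [this, ← EReal.coe_neg, EReal.real_coe_toENNReal, EReal.toReal_coe,
      Real.enorm_of_nonneg (le_max_left _ _), max_comm, ENNReal.ofReal_max, ENNReal.ofReal_zero]
    simp

/-- The excess of the negative part over `C` vanishes where that part is below `C`; this links the
tail in `lowerSemicontinuousAt_expect` to uniform integrability. -/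
theorem toENNReal_neg_sub_le_enorm_indicator {Z : Type*} {f : Z → EReal} (hf : ∀ z, f z ≠ ⊥)
    (C : ℝ≥0) (z : Z) :
    (-f z - C).toENNReal ≤
      ‖{z | C ≤ ‖(-min 0 (f z)).toReal‖₊}.indicator (fun z => (-min 0 (f z)).toReal) z‖ₑ := by
  by_cases hz : C ≤ ‖(-min 0 (f z)).toReal‖₊
  · rw [indicator_of_mem (by exact hz), ← toENNReal_neg_eq_enorm (hf z)]
    refine EReal.toENNReal_le_toENNReal ?_
    have h := EReal.sub_le_sub (le_refl (-f z)) (EReal.coe_ennreal_nonneg (C : ℝ≥0∞))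
    simpa using h
  · rw [EReal.toENNReal_of_nonpos]
    · exact bot_le
    have h1 : (-f z).toENNReal ≤ C := by
      rw [toENNReal_neg_eq_enorm (hf z), enorm_eq_nnnorm]
      exact_mod_cast (not_le.1 hz).le
    have h2 : -f z ≤ ((-f z).toENNReal : EReal) := by
      rw [EReal.coe_toENNReal_eq_max]; exact le_max_right _ _
    rw [EReal.sub_nonpos]
    exact h2.trans (EReal.coe_ennreal_le_coe_ennreal_iff.2 h1)

end TruncatedLoss

/-! ### Weak duality and saddle points. -/

section Values

variable {E Z : Type*} [MeasurableSpace Z] {Θ : Set E} {B : Set (ProbabilityMeasure Z)}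
  {ℓ : E → Z → EReal}

theorem bestCase_le_worstCase {θ : E} (hθ : θ ∈ Θ) {Q : ProbabilityMeasure Z} (hQ : Q ∈ B) :
    bestCase Θ ℓ Q ≤ worstCase B ℓ θ :=
  (iInf₂_le (f := fun θ (_ : θ ∈ Θ) => expect Q (ℓ θ)) θ hθ).trans
    (le_iSup₂ (f := fun Q (_ : Q ∈ B) => expect Q (ℓ θ)) Q hQ)

theorem dualValue_le_primalValue : dualValue Θ B ℓ ≤ primalValue Θ B ℓ :=
  iSup₂_le fun _ hQ => le_iInf₂ fun _ hθ => bestCase_le_worstCase hθ hQ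

theorem primalValue_le_worstCase {θ : E} (hθ : θ ∈ Θ) :
    primalValue Θ B ℓ ≤ worstCase B ℓ θ :=
  iInf₂_le (f := fun θ (_ : θ ∈ Θ) => worstCase B ℓ θ) θ hθ

theorem bestCase_le_dualValue {Q : ProbabilityMeasure Z} (hQ : Q ∈ B) :
    bestCase Θ ℓ Q ≤ dualValue Θ B ℓ :=
  le_iSup₂ (f := fun Q (_ : Q ∈ B) => bestCase Θ ℓ Q) Q hQ

theorem isNash_of_eq {θs : E} {Qs : ProbabilityMeasure Z} (hθ : θs ∈ Θ) (hQ : Qs ∈ B)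
    (h₁ : worstCase B ℓ θs = primalValue Θ B ℓ) (h₂ : bestCase Θ ℓ Qs = dualValue Θ B ℓ)
    (h : primalValue Θ B ℓ = dualValue Θ B ℓ) : IsNash Θ B ℓ θs Qs := by
  have hle : worstCase B ℓ θs = bestCase Θ ℓ Qs := h₁.trans (h.trans h₂.symm)
  refine ⟨hθ, hQ, fun Q hQ' => ?_, fun θ hθ' => ?_⟩
  · exact (le_iSup₂ (f := fun Q (_ : Q ∈ B) => expect Q (ℓ θs)) Q hQ').trans
      (hle.le.trans (iInf₂_le (f := fun θ (_ : θ ∈ Θ) => expect Qs (ℓ θ)) θs hθ))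
  · exact (le_iSup₂ (f := fun Q (_ : Q ∈ B) => expect Q (ℓ θs)) Qs hQ).trans
      (hle.le.trans (iInf₂_le (f := fun θ (_ : θ ∈ Θ) => expect Qs (ℓ θ)) θ hθ'))

end Values

/-! ### Attainment of the primal minimum. -/

section Primal

variable {E Z : Type*} [MeasurableSpace Z] [TopologicalSpace E]
  {Θ : Set E} {B : Set (ProbabilityMeasure Z)} {ℓ : E → Z → EReal}

theorem LossNegUnifIntegrable.lintegral_ne_top (h : LossNegUnifIntegrable Θ B ℓ)
    (hbot : ∀ θ ∈ Θ, ∀ z, ℓ θ z ≠ ⊥) {Q : ProbabilityMeasure Z} (hQ : Q ∈ B) {θ : E}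
    (hθ : θ ∈ Θ) : ∫⁻ z, (-ℓ θ z).toENNReal ∂(Q : Measure Z) ≠ ∞ := by
  obtain ⟨U, hU, hUI⟩ := h Q hQ θ hθ
  have h1 := hUI.memLp ⟨θ, mem_of_mem_nhds hU, hθ⟩
  have h2 := h1.2.ne
  rw [eLpNorm_one_eq_lintegral_enorm] at h2
  simpa only [toENNReal_neg_eq_enorm (hbot θ hθ _)] using h2

variable [FirstCountableTopology E]

theorem lowerSemicontinuous_expect_of_unifIntegrable (h : LossNegUnifIntegrable Θ B ℓ)
    (hlsc : LossLsc Θ ℓ) (hbot : ∀ θ ∈ Θ, ∀ z, ℓ θ z ≠ ⊥) (hmeas : ∀ θ ∈ Θ, Measurable (ℓ θ))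
    {Q : ProbabilityMeasure Z} (hQ : Q ∈ B) :
    LowerSemicontinuous fun θ : Θ => expect Q (ℓ θ) := by
  intro θ₀
  refine lowerSemicontinuousAt_expect (Q := fun _ : Θ => Q) (f := fun θ : Θ => ℓ θ)
    (fun θ => hmeas θ θ.2) (fun θ : Θ => h.lintegral_ne_top hbot hQ θ.2) fun η hη => ?_
  obtain ⟨U, hU, hUI⟩ := h Q hQ θ₀ θ₀.2
  obtain ⟨C, hC⟩ := hUI.spec one_ne_zero ENNReal.one_ne_top hη
  refine ⟨C, ?_, ?_⟩
  · filter_upwards [continuous_subtype_val.continuousAt.preimage_mem_nhds hU] with θ hθ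
    have h1 := hC ⟨θ, hθ, θ.2⟩
    rw [eLpNorm_one_eq_lintegral_enorm] at h1
    exact (lintegral_mono (toENNReal_neg_sub_le_enorm_indicator (hbot θ.1 θ.2) C)).trans h1
  · refine lowerSemicontinuousAt_lintegral (fun θ : Θ =>
      (continuous_toENNReal_add_coe C).measurable.comp (hmeas θ θ.2)) fun z => ?_
    exact (continuous_toENNReal_add_coe C).continuousAt.comp_lowerSemicontinuousAt
      (lowerSemicontinuous_restrict_iff.2 (hlsc z) θ₀) (monotone_toENNReal_add_coe C)

variable [AddCommGroup E] [Module ℝ E]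

theorem exists_worstCase_eq_primalValue (hΘ : Convex ℝ Θ)
    (hconv : ∀ z, ConvexOnE Θ fun θ => ℓ θ z) (hbot : ∀ θ ∈ Θ, ∀ z, ℓ θ z ≠ ⊥)
    (hmeas : ∀ θ ∈ Θ, Measurable (ℓ θ))
    (hB : ∀ Q₁ ∈ B, ∀ Q₂ ∈ B, ∀ (a b : ℝ) (ha : 0 ≤ a) (hb : 0 ≤ b) (hab : a + b = 1),
      mixture a b ha hb hab Q₁ Q₂ ∈ B)
    (hlsc : LossLsc Θ ℓ) (hUI : LossNegUnifIntegrable Θ B ℓ) (hcomp : LossInfCompact Θ B ℓ)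
    (hprop : ProperPrimal Θ B ℓ) :
    (∃ θs ∈ Θ, worstCase B ℓ θs = primalValue Θ B ℓ) ∧
      primalValue Θ B ℓ = dualValue Θ B ℓ := by
  obtain ⟨Q₀, hQ₀, hcomp⟩ := hcomp
  obtain ⟨θ₀, hθ₀, hfin⟩ := hprop
  have hneg : ∀ (θ : Θ) (Q : B), ∫⁻ z, (-ℓ θ z).toENNReal ∂((Q : ProbabilityMeasure Z) : Measure Z)
      ≠ ∞ := fun θ Q => hUI.lintegral_ne_top hbot Q.2 θ.2
  obtain ⟨θs, hθs⟩ := exists_iSup_le_iSup_iInf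
    (F := fun (θ : Θ) (Q : B) => expect (Q : ProbabilityMeasure Z) (ℓ θ))
    (fun θ Q => expect_ne_bot (hneg θ Q))
    (fun Q => lowerSemicontinuous_expect_of_unifIntegrable hUI hlsc hbot hmeas Q.2)
    (fun θ₁ θ₂ a b ha hb hab => by
      refine ⟨⟨a • θ₁ + b • θ₂, hΘ θ₁.2 θ₂.2 ha.le hb.le hab⟩, fun Q u₁ u₂ h₁ h₂ => ?_⟩
      refine sub_le_of_add_le_add ha.le hb.le (hneg _ Q) (hneg θ₁ Q) (hneg θ₂ Q) ?_ h₁ h₂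
      exact lintegral_toENNReal_add_le (hmeas _ (hΘ θ₁.2 θ₂.2 ha.le hb.le hab)) (hmeas _ θ₁.2)
        (hmeas _ θ₂.2) ha hb (hbot _ θ₁.2) (hbot _ θ₂.2)
        fun z => hconv z _ θ₁.2 _ θ₂.2 a b ha.le hb.le hab)
    (fun Q₁ Q₂ a b ha hb hab => by
      refine ⟨⟨_, hB Q₁ Q₁.2 Q₂ Q₂.2 a b ha.le hb.le hab⟩, fun θ u₁ u₂ h₁ h₂ => ?_⟩
      refine le_sub_of_add_le_add ha hb (hneg θ ⟨_, hB Q₁ Q₁.2 Q₂ Q₂.2 a b ha.le hb.le hab⟩)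
        (hneg θ Q₁) (hneg θ Q₂) (le_of_eq ?_) h₁ h₂
      simp only [lintegral_mixture]
      rw [add_comm])
    (y₀ := ⟨Q₀, hQ₀⟩)
    (fun a => by
      rw [Subtype.isCompact_iff]
      convert hcomp a using 1
      ext θ
      simp [and_comm])
    (x₀ := ⟨θ₀, hθ₀⟩) (by rwa [worstCase, iSup_subtype'] at hfin)
  have hle : worstCase B ℓ θs ≤ dualValue Θ B ℓ := by
    simpa only [worstCase, dualValue, bestCase, iSup_subtype', iInf_subtype'] using hθs
  have h₁ := primalValue_le_worstCase (B := B) (ℓ := ℓ) θs.2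
  have h₂ := dualValue_le_primalValue (Θ := Θ) (B := B) (ℓ := ℓ)
  exact ⟨⟨θs, θs.2, le_antisymm (hle.trans h₂) h₁⟩, le_antisymm (h₁.trans hle) h₂⟩

end Primal

/-! ### Attainment of the dual maximum. -/

section Dual

variable {E Z : Type*} [MeasurableSpace Z] [MetricSpace Z]
  {Θ : Set E} {ℓ : E → Z → EReal} {c : Z → Z → ℝ≥0∞} {d : Z → Z → ℝ} {p : ℕ}
  {Phat : ProbabilityMeasure Z}

theorem LossGrowth.lintegral_ne_top (hgrow : LossGrowth Θ ℓ d p)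
    (hc : Measurable fun x : Z × Z => c x.1 x.2) (hint : CostIntegrable c Phat)
    (hlow : CostLowerBound c d p) {ε : ℝ≥0} {θ : E} (hθ : θ ∈ Θ) {Q : ProbabilityMeasure Z}
    (hQ : Q ∈ ambiguitySet c ε Phat) :
    ∫⁻ z, (ℓ θ z).toENNReal ∂(Q : Measure Z) ≠ ∞ := by
  obtain ⟨g, hg, z₁, r, hr, hrp, hf⟩ := hgrow θ hθ
  exact lintegral_toENNReal_ne_top hc hint hlow hg hr hrp hf hQ

variable [SecondCountableTopology Z] [BorelSpace Z]

/-- Growth below order `p` makes the upper tail of the loss small uniformly on the ambiguity set;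
after the shift by `M`, the truncated `-ℓ θ` is nonnegative and lower semicontinuous. -/
theorem lowerSemicontinuous_expect_neg (hgrow : LossGrowth Θ ℓ d p)
    (hc : Measurable fun x : Z × Z => c x.1 x.2) (hint : CostIntegrable c Phat)
    (hlow : CostLowerBound c d p) (ε : ℝ≥0) {θ : E} (hθ : θ ∈ Θ)
    (husc : UpperSemicontinuous (ℓ θ)) (hmeas : Measurable (ℓ θ)) :
    LowerSemicontinuous fun Q : ambiguitySet c ε Phat =>
      expect (Q : ProbabilityMeasure Z) fun z => -ℓ θ z := by
  intro Q₀
  refine lowerSemicontinuousAt_expect (X := ambiguitySet c ε Phat) (Q := Subtype.val)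
    (f := fun _ z => -ℓ θ z)
    (fun _ => hmeas.neg) (fun Q => ?_) fun η hη => ?_
  · simpa only [neg_neg] using hgrow.lintegral_ne_top hc hint hlow hθ Q.2
  · obtain ⟨g, hg, z₁, r, hr, hrp, hf⟩ := hgrow θ hθ
    obtain ⟨M, hM⟩ := exists_tail_bound hc hint hlow ε hg hr hrp hf hη
    refine ⟨M, .of_forall fun Q => by simpa only [neg_neg] using hM Q Q.2, ?_⟩
    have hlsc : LowerSemicontinuous fun z => (-ℓ θ z + M).toENNReal :=
      Continuous.comp_upperSemicontinuous_antitone (g := fun x : EReal => (-x + M).toENNReal)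
        ((continuous_toENNReal_add_coe M).comp continuous_neg) husc
        fun _ _ h => monotone_toENNReal_add_coe M (EReal.neg_le_neg_iff.2 h)
    exact ((lowerSemicontinuous_lintegral hlsc).comp continuous_subtype_val) Q₀

variable [CompleteSpace Z] [AddCommGroup E] [Module ℝ E]

theorem exists_bestCase_eq_dualValue (hΘne : Θ.Nonempty) (hΘ : Convex ℝ Θ)
    (hconv : ∀ z, ConvexOnE Θ fun θ => ℓ θ z) (hbot : ∀ θ ∈ Θ, ∀ z, ℓ θ z ≠ ⊥)
    (hmeas : ∀ θ ∈ Θ, Measurable (ℓ θ)) (ε : ℝ≥0)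
    (hcont : ContinuityAssumption Θ c ℓ Phat) (hint : CostIntegrable c Phat)
    (hlow : CostLowerBound c d p) (hgrow : LossGrowth Θ ℓ d p)
    (hprop : ProperDual Θ (ambiguitySet c ε Phat) ℓ) :
    (∃ Qs ∈ ambiguitySet c ε Phat,
      bestCase Θ ℓ Qs = dualValue Θ (ambiguitySet c ε Phat) ℓ) ∧
      primalValue Θ (ambiguitySet c ε Phat) ℓ = dualValue Θ (ambiguitySet c ε Phat) ℓ := by
  obtain ⟨hclsc, husc⟩ := hcont
  have hc : Measurable fun x : Z × Z => c x.1 x.2 := hclsc.measurable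
  obtain ⟨Q₀, hQ₀, hfin⟩ := hprop
  obtain ⟨θ₀, hθ₀⟩ := hΘne
  set B := ambiguitySet c ε Phat with hB
  have : CompactSpace B := isCompact_iff_compactSpace.1 (isCompact_ambiguitySet hclsc hint hlow ε)
  have hpos : ∀ (Q : B) (θ : Θ), ∫⁻ z, (ℓ θ z).toENNReal ∂((Q : ProbabilityMeasure Z) : Measure Z)
      ≠ ∞ := fun Q θ => hgrow.lintegral_ne_top hc hint hlow θ.2 Q.2
  have hneg : ∀ (Q : B) (θ : Θ),
      ∫⁻ z, (-(-ℓ θ z)).toENNReal ∂((Q : ProbabilityMeasure Z) : Measure Z) ≠ ∞ := fun Q θ => by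
    simpa only [neg_neg] using hpos Q θ
  have hlsc : ∀ θ : Θ, LowerSemicontinuous fun Q : B =>
      expect (Q : ProbabilityMeasure Z) fun z => -ℓ θ z := fun θ =>
    lowerSemicontinuous_expect_neg hgrow hc hint hlow ε θ.2 (husc θ θ.2).1 (hmeas θ θ.2)
  have hexp : ∀ (Q : B) (θ : Θ), expect (Q : ProbabilityMeasure Z) (fun z => -ℓ θ z)
      = -expect (Q : ProbabilityMeasure Z) (ℓ θ) := fun Q θ => expect_neg (hpos Q θ)
  obtain ⟨Qs, hQs⟩ := exists_iSup_le_iSup_iInf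
    (F := fun (Q : B) (θ : Θ) => expect (Q : ProbabilityMeasure Z) fun z => -ℓ θ z)
    (fun Q θ => expect_ne_bot (hneg Q θ)) hlsc
    (fun Q₁ Q₂ a b ha hb hab => by
      refine ⟨⟨mixture a b ha.le hb.le hab Q₁ Q₂, mixture_mem_ambiguitySet Q₁.2 Q₂.2⟩,
        fun θ u₁ u₂ h₁ h₂ => ?_⟩
      refine sub_le_of_add_le_add ha.le hb.le
        (hneg ⟨mixture a b ha.le hb.le hab Q₁ Q₂, mixture_mem_ambiguitySet Q₁.2 Q₂.2⟩ θ)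
        (hneg Q₁ θ) (hneg Q₂ θ) (le_of_eq ?_) h₁ h₂
      simp only [lintegral_mixture]
      rw [add_comm])
    (fun θ₁ θ₂ a b ha hb hab => by
      refine ⟨⟨a • θ₁ + b • θ₂, hΘ θ₁.2 θ₂.2 ha.le hb.le hab⟩, fun Q u₁ u₂ h₁ h₂ => ?_⟩
      refine le_sub_of_add_le_add ha hb (hneg Q _) (hneg Q θ₁) (hneg Q θ₂) ?_ h₁ h₂
      simp only [neg_neg]
      exact lintegral_toENNReal_add_le (hmeas _ (hΘ θ₁.2 θ₂.2 ha.le hb.le hab)) (hmeas _ θ₁.2)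
        (hmeas _ θ₂.2) ha hb (hbot _ θ₁.2) (hbot _ θ₂.2)
        fun z => hconv z _ θ₁.2 _ θ₂.2 a b ha.le hb.le hab)
    -- Any decision will do: the ambiguity set is compact, so closed sublevel sets are compact.
    (y₀ := ⟨θ₀, hθ₀⟩) (fun a => ((hlsc ⟨θ₀, hθ₀⟩).isClosed_preimage a).isCompact)
    (x₀ := ⟨Q₀, hQ₀⟩) (by
      refine lt_of_le_of_lt (iSup_le fun θ => ?_)
        (lt_top_iff_ne_top.2 (EReal.neg_eq_top_iff.not.2 hfin.ne'))
      rw [hexp]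
      exact EReal.neg_le_neg_iff.2
        (iInf₂_le (f := fun θ (_ : θ ∈ Θ) => expect Q₀ (ℓ θ)) θ θ.2))
  -- Negating the minimax inequality for `-ℓ` turns its sup-inf into the negative of the primal
  -- value.
  have hle : primalValue Θ B ℓ ≤ bestCase Θ ℓ Qs := by
    refine le_iInf₂ fun θ hθ => ?_
    have h₁ := (le_iSup _ (⟨θ, hθ⟩ : Θ)).trans hQs
    rw [hexp] at h₁
    refine EReal.neg_le_neg_iff.1 (h₁.trans (iSup_le fun θ' => ?_))
    rw [EReal.le_neg]
    refine (primalValue_le_worstCase θ'.2).trans (iSup₂_le fun Q hQ => ?_)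
    rw [EReal.le_neg, ← hexp ⟨Q, hQ⟩ θ']
    exact iInf_le (fun Q : B => expect (Q : ProbabilityMeasure Z) fun z => -ℓ θ' z) ⟨Q, hQ⟩
  have h₁ := bestCase_le_dualValue (Θ := Θ) (ℓ := ℓ) Qs.2
  have h₂ := dualValue_le_primalValue (Θ := Θ) (B := B) (ℓ := ℓ)
  exact ⟨⟨Qs, Qs.2, le_antisymm h₁ (h₂.trans hle)⟩, le_antisymm (hle.trans h₁) h₂⟩

end Dual

end DRO

end

/-! ### The minimax theorem for the ambiguity set. -/

theorem theorem2p7 {m n : ℕ}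
    -- feasible set and support set
    (Θ : Set (EuclideanSpace ℝ (Fin m))) (hΘne : Θ.Nonempty) (hΘcl : IsClosed Θ)
    (𝒵 : Set (EuclideanSpace ℝ (Fin n))) (h𝒵ne : 𝒵.Nonempty) (h𝒵cl : IsClosed 𝒵)
    -- transportation cost, radius, reference distribution
    (c : 𝒵 → 𝒵 → ℝ≥0∞) (hc_meas : Measurable (fun x : 𝒵 × 𝒵 => c x.1 x.2))
    (hc_zero : ∀ z zhat, c z zhat = 0 ↔ z = zhat)
    (ε : ℝ≥0) (Phat : ProbabilityMeasure 𝒵)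
    -- loss function (only its values on Θ × 𝒵 matter), with values in (-∞, ∞]
    (ℓ : EuclideanSpace ℝ (Fin m) → 𝒵 → EReal)
    (hℓ_bot : ∀ θ ∈ Θ, ∀ z, ℓ θ z ≠ ⊥) (hℓ_meas : ∀ θ ∈ Θ, Measurable (ℓ θ))
    -- convexity
    (hΘ : Convex ℝ Θ) (hℓ : ∀ z, DRO.ConvexOnE Θ (fun θ => ℓ θ z)) :
    -- (i)
    (DRO.LossLsc Θ ℓ →
      DRO.LossNegUnifIntegrable Θ (DRO.ambiguitySet c ε Phat) ℓ →
      DRO.LossInfCompact Θ (DRO.ambiguitySet c ε Phat) ℓ →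
      DRO.ProperPrimal Θ (DRO.ambiguitySet c ε Phat) ℓ →
      (∃ θs ∈ Θ, DRO.worstCase (DRO.ambiguitySet c ε Phat) ℓ θs
          = DRO.primalValue Θ (DRO.ambiguitySet c ε Phat) ℓ) ∧
        DRO.primalValue Θ (DRO.ambiguitySet c ε Phat) ℓ
          = DRO.dualValue Θ (DRO.ambiguitySet c ε Phat) ℓ) ∧
    -- (ii)
    (DRO.ContinuityAssumption Θ c ℓ Phat →
      DRO.CostIntegrable c Phat →
      (∃ (d : 𝒵 → 𝒵 → ℝ) (p : ℕ), DRO.CostLowerBound c d p ∧ DRO.LossGrowth Θ ℓ d p) →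
      DRO.ProperDual Θ (DRO.ambiguitySet c ε Phat) ℓ →
      (∃ Qs ∈ DRO.ambiguitySet c ε Phat, DRO.bestCase Θ ℓ Qs
          = DRO.dualValue Θ (DRO.ambiguitySet c ε Phat) ℓ) ∧
        DRO.primalValue Θ (DRO.ambiguitySet c ε Phat) ℓ
          = DRO.dualValue Θ (DRO.ambiguitySet c ε Phat) ℓ) ∧
    -- (iii)
    (DRO.ContinuityAssumption Θ c ℓ Phat →
      DRO.CostIntegrable c Phat →
      (∃ (d : 𝒵 → 𝒵 → ℝ) (p : ℕ), DRO.CostLowerBound c d p ∧ DRO.LossGrowth Θ ℓ d p) →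
      DRO.LossLsc Θ ℓ →
      DRO.LossNegUnifIntegrable Θ (DRO.ambiguitySet c ε Phat) ℓ →
      DRO.LossInfCompact Θ (DRO.ambiguitySet c ε Phat) ℓ →
      DRO.ProperPrimal Θ (DRO.ambiguitySet c ε Phat) ℓ →
      DRO.ProperDual Θ (DRO.ambiguitySet c ε Phat) ℓ →
      ∃ θs ∈ Θ, ∃ Qs ∈ DRO.ambiguitySet c ε Phat,
        DRO.worstCase (DRO.ambiguitySet c ε Phat) ℓ θs
          = DRO.primalValue Θ (DRO.ambiguitySet c ε Phat) ℓ ∧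
        DRO.bestCase Θ ℓ Qs = DRO.dualValue Θ (DRO.ambiguitySet c ε Phat) ℓ ∧
        DRO.primalValue Θ (DRO.ambiguitySet c ε Phat) ℓ
          = DRO.dualValue Θ (DRO.ambiguitySet c ε Phat) ℓ ∧
        DRO.IsNash Θ (DRO.ambiguitySet c ε Phat) ℓ θs Qs) := by
  have : CompleteSpace 𝒵 := h𝒵cl.completeSpace_coe
  refine ⟨fun hlsc hUI hcomp hprop => ?_, fun hcont hint hgrow hprop => ?_,
    fun hcont hint hgrow hlsc hUI hcomp hprop hprop' => ?_⟩
  · exact DRO.exists_worstCase_eq_primalValue hΘ hℓ hℓ_bot hℓ_meas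
      (fun _ h₁ _ h₂ _ _ _ _ _ => DRO.mixture_mem_ambiguitySet h₁ h₂) hlsc hUI hcomp hprop
  · obtain ⟨d, p, hlow, hgrow⟩ := hgrow
    exact DRO.exists_bestCase_eq_dualValue hΘne hΘ hℓ hℓ_bot hℓ_meas ε hcont hint hlow hgrow hprop
  · obtain ⟨d, p, hlow, hgrow⟩ := hgrow
    obtain ⟨⟨θs, hθs, h₁⟩, h⟩ := DRO.exists_worstCase_eq_primalValue hΘ hℓ hℓ_bot hℓ_meas
      (fun _ h₁ _ h₂ _ _ _ _ _ => DRO.mixture_mem_ambiguitySet h₁ h₂) hlsc hUI hcomp hprop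
    obtain ⟨⟨Qs, hQs, h₂⟩, -⟩ := DRO.exists_bestCase_eq_dualValue hΘne hΘ hℓ hℓ_bot hℓ_meas ε
      hcont hint hlow hgrow hprop'
    exact ⟨θs, hθs, Qs, hQs, h₁, h₂, h, DRO.isNash_of_eq hθs hQs h₁ h₂ h⟩
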